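/- Setting. A parameterized state $\rho_\theta$ on $\mathbb{C}^d$ depends on $m$ real parameters $\theta=(\theta_1,\dots,\theta_m)$; it is a density operator for all parameters near the local point $\theta$ considered, its partial derivatives $\partial_i\rho_\theta$ at that point exist, and they are linearly independent over $\mathbb{R}$. Let $\rho_\theta=\sum_k\lambda_k|\psi_k\rangle\langle\psi_k|$ be the spectral decomposition at the local point. The quantum Fisher information matrix is $J_{ij}=\frac12\mathrm{Tr}(\rho_\theta\{L_i,L_j\})$ with $L_i=2\sum_{j,k:\,\lambda_j+\lambda_k>0}\frac{\langle\psi_j|\partial_i\rho_\theta|\psi_k\rangle}{\lambda_j+\lambda_k}|\psi_j\rangle\langle\psi_k|$. For a POVM $M=\{M_x\}_x$ (finitely many positive semidefinite operators with $\sum_x M_x=\mathbb{1}$) and $p_x=\mathrm{Tr}(\rho_\theta M_x)$, the classical Fisher information matrix is $I(M)_{ij}=\sum_{x:\,p_x\neq0}\frac1{p_x}\,\partial_ip_x\,\partial_jp_x$. The POVM $M$ is given by a $3$-design if $M=\{q_s d\,|s\rangle\langle s|\}_s$ with $q_s>0$, unit vectors $|s\rangle$, and $\sum_s q_s(|s\rangle\langle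 s|)^{\otimes3}=\int(|\psi\rangle\langle\psi|)^{\otimes3}\,d\psi$, where $d\psi$ is the Haar probability measure on pure states of $\mathbb{C}^d$. Write $r$ for the rank of $\rho_\theta$, $\Pi$ for the orthogonal projection onto its support, and call $\rho_\theta$ $\kappa$-well-conditioned if the ratio between its largest and its smallest nonzero eigenvalue is at most $\kappa$. Theorem. For every real $\kappa$ and in each of the following three cases there are constants $c_1,c_2>0$, depending only on $\kappa$ (in particular not on $d$, $r$, $m$, the state or the measurement), such that for every $\kappa$-well-conditioned parameterized state as in that case and every POVM $M$ on $\mathbb{C}^d$ given by a $3$-design, the matrix $I(M)$ is positive definite, $$\mathrm{Tr}\big(J\,I(M)^{-1}\big)\le c_1\inf_{\tilde M}\mathrm{Tr}\big(J\,I(\tilde M)^{-1}\big)\quad\text{and}\quad I(M)\succeq c_2\,\frac{\mathrm{Tr}(J^{-1}I(M))}{m}\,J ,$$ where the infimum is over all POVMs $\tilde M$ on $\mathbb{C}^d$ and $\mathrm{Tr}(J\,I(\tilde M)^{-1})=\infty$ if $I(\tilde M)$ is singular (for $m=0$ all the matrices are empty and the assertion is trivial). That is, $3$-design POVMs are weakly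 near-optimal for each of these families: 1. states with the maximal number of parameters $m=r(2d-r)-1$; 2. states with $\Pi\,\partial_i\rho_\theta\,\Pi=\partial_i\rho_\theta$ for all $i$, and $m=r^2-1$; 3. states with $\Pi\,\partial_i\rho_\theta\,\Pi=0$ for all $i$, and $m=2r(d-r)$. -/

import Mathlib

open MeasureTheory Matrix Filter Topology
open scoped ENNReal Kronecker ComplexOrder

namespace QuantumMetrology

/-- Density operators on `ℂ^d`. -/
structure IsDensity {d : ℕ} (ρ : Matrix (Fin d) (Fin d) ℂ) : Prop where
  posSemidef : ρ.PosSemidef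
  trace_eq_one : ρ.trace = 1

/-- A positive operator-valued measure on `ℂ^d` with finitely many outcomes. -/
structure POVM (d : ℕ) where
  /-- the number of outcomes -/
  n : ℕ
  /-- the measurement operators `M_x` -/
  op : Fin n → Matrix (Fin d) (Fin d) ℂ
  posSemidef : ∀ x, (op x).PosSemidef
  sum_eq_one : ∑ x, op x = 1

/-! ### Complex projective `3`-designs -/

/-- The rank-one operator `|v⟩⟨v|`. -/
def ketbra {d : ℕ} (v : EuclideanSpace ℂ (Fin d)) : Matrix (Fin d) (Fin d) ℂ :=
  Matrix.of fun a b => v a * star (v b)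

/-- The third tensor power `A ⊗ A ⊗ A`. -/
def tensorCube {d : ℕ} (A : Matrix (Fin d) (Fin d) ℂ) :
    Matrix (Fin d × Fin d × Fin d) (Fin d × Fin d × Fin d) ℂ :=
  A ⊗ₖ (A ⊗ₖ A)

/-- The normalized surface measure on the unit sphere of `ℂ^d`, i.e. the law of a Haar random pure
state (its image under `ψ ↦ |ψ⟩⟨ψ|` is the Haar measure of the complex projective space). -/
noncomputable def haarSphere (d : ℕ) :
    Measure (Metric.sphere (0 : EuclideanSpace ℂ (Fin d)) 1) :=
  ((volume : Measure (EuclideanSpace ℂ (Fin d))).toSphere Set.univ)⁻¹ •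
    (volume : Measure (EuclideanSpace ℂ (Fin d))).toSphere

/-- The Haar average `∫ (|ψ⟩⟨ψ|)^{⊗3} dψ`, entry by entry. -/
noncomputable def haarThirdMoment (d : ℕ) :
    Matrix (Fin d × Fin d × Fin d) (Fin d × Fin d × Fin d) ℂ :=
  Matrix.of fun a b =>
    ∫ ψ : Metric.sphere (0 : EuclideanSpace ℂ (Fin d)) 1,
      tensorCube (ketbra (ψ : EuclideanSpace ℂ (Fin d))) a b ∂(haarSphere d)

/-- The weighted unit vectors `(q_s, |s⟩)` form a complex projective `3`-design. -/
def IsProjectiveThreeDesign {d n : ℕ} (q : Fin n → ℝ) (v : Fin n → EuclideanSpace ℂ (Fin d)) :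
    Prop :=
  ∑ s, (q s : ℂ) • tensorCube (ketbra (v s)) = haarThirdMoment d

/-- The POVM is given by a `3`-design: `M_s = q_s d |s⟩⟨s|` with `q_s > 0`, unit vectors `|s⟩`,
and `(q_s, |s⟩)` a complex projective `3`-design. -/
def POVM.IsThreeDesign {d : ℕ} (M : POVM d) : Prop :=
  ∃ (q : Fin M.n → ℝ) (v : Fin M.n → EuclideanSpace ℂ (Fin d)),
    (∀ s, 0 < q s) ∧ (∀ s, ‖v s‖ = 1) ∧
    (∀ s, M.op s = ((q s * d : ℝ) : ℂ) • ketbra (v s)) ∧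
    IsProjectiveThreeDesign q v

/-! ### Spectral data and the quantum Fisher information matrix -/

section Spectral

variable {d m : ℕ} {ρ : Matrix (Fin d) (Fin d) ℂ}

/-- The orthogonal projection `∑_{λ_k > 0} |ψ_k⟩⟨ψ_k|` onto the support of a positive
semidefinite `ρ = ∑ λ_k |ψ_k⟩⟨ψ_k|`. -/
noncomputable def supportProj (hρ : ρ.IsHermitian) : Matrix (Fin d) (Fin d) ℂ :=
  (hρ.eigenvectorUnitary : Matrix (Fin d) (Fin d) ℂ) *
    Matrix.diagonal (fun k => if 0 < hρ.eigenvalues k then (1 : ℂ) else 0) *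
    (hρ.eigenvectorUnitary : Matrix (Fin d) (Fin d) ℂ)ᴴ

/-- The symmetric logarithmic derivative
`L = 2 ∑_{λ_j + λ_k > 0} ⟨ψ_j|D|ψ_k⟩ / (λ_j + λ_k) |ψ_j⟩⟨ψ_k|` of `ρ = ∑ λ_k |ψ_k⟩⟨ψ_k|` in the
direction of the derivative `D`. -/
noncomputable def sld (hρ : ρ.IsHermitian) (D : Matrix (Fin d) (Fin d) ℂ) :
    Matrix (Fin d) (Fin d) ℂ :=
  (hρ.eigenvectorUnitary : Matrix (Fin d) (Fin d) ℂ) *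
    (Matrix.of fun j k =>
      if 0 < hρ.eigenvalues j + hρ.eigenvalues k then
        2 * ((hρ.eigenvectorUnitary : Matrix (Fin d) (Fin d) ℂ)ᴴ * D *
          (hρ.eigenvectorUnitary : Matrix (Fin d) (Fin d) ℂ)) j k /
          ((hρ.eigenvalues j + hρ.eigenvalues k : ℝ) : ℂ)
      else 0) *
    (hρ.eigenvectorUnitary : Matrix (Fin d) (Fin d) ℂ)ᴴ

/-- The matrix `½ Tr(ρ {L_i, L_j})`, where `L_i` is the symmetric logarithmic derivative for the
derivative `D i`. -/
noncomputable def qfimOf (hρ : ρ.IsHermitian) (D : Fin m → Matrix (Fin d) (Fin d) ℂ) :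
    Matrix (Fin m) (Fin m) ℝ :=
  Matrix.of fun i j =>
    (1 / 2) * (Matrix.trace
      (ρ * (sld hρ (D i) * sld hρ (D j) + sld hρ (D j) * sld hρ (D i)))).re

end Spectral

/-! ### Parameterized states -/

/-- A parameterized quantum state `η ↦ ρ η` with `m` real parameters on `ℂ^d`, together with the
local point `θ` at which it is studied: near `θ` all the `ρ η` are density operators, and the
partial derivatives at `θ` exist. -/
structure ParamState where
  /-- dimension of the Hilbert space -/
  d : ℕ
  /-- number of parameters -/
  m : ℕ
  /-- the state as a function of the parameters -/
  ρ : (Fin m → ℝ) → Matrix (Fin d) (Fin d) ℂ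
  /-- the local point -/
  θ : Fin m → ℝ
  isDensity : ∀ᶠ η in 𝓝 θ, IsDensity (ρ η)
  differentiable : ∀ i a b, LineDifferentiableAt ℝ (fun η => ρ η a b) θ (Pi.single i 1)

namespace ParamState

variable (S : ParamState)

/-- The state at the local point. -/
def state : Matrix (Fin S.d) (Fin S.d) ℂ := S.ρ S.θ

theorem state_isDensity : IsDensity S.state := S.isDensity.self_of_nhds

theorem state_isHermitian : S.state.IsHermitian := S.state_isDensity.posSemidef.isHermitian

/-- The partial derivative `∂_i ρ` at the local point. -/
noncomputable def pderiv (i : Fin S.m) : Matrix (Fin S.d) (Fin S.d) ℂ :=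
  Matrix.of fun a b => lineDeriv ℝ (fun η => S.ρ η a b) S.θ (Pi.single i 1)

/-- No parameter is redundant to first order: the partial derivatives are linearly independent
over `ℝ`. -/
def IsIdentifiable : Prop := LinearIndependent ℝ S.pderiv

/-- The rank of the state at the local point. -/
noncomputable def rank : ℕ := S.state.rank

/-- The projection onto the support of the state at the local point. -/
noncomputable def proj : Matrix (Fin S.d) (Fin S.d) ℂ := supportProj S.state_isHermitian

/-- The ratio between the largest and the smallest nonzero eigenvalue of the state is at most
`κ`. -/
def IsWellConditioned (κ : ℝ) : Prop :=
  ∀ k l, 0 < S.state_isHermitian.eigenvalues l →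
    S.state_isHermitian.eigenvalues k ≤ κ * S.state_isHermitian.eigenvalues l

/-- The quantum Fisher information matrix `J`. -/
noncomputable def qfim : Matrix (Fin S.m) (Fin S.m) ℝ := qfimOf S.state_isHermitian S.pderiv

/-- The outcome probability `p_x(η) = Tr(ρ_η M_x)`. -/
noncomputable def prob (M : POVM S.d) (x : Fin M.n) (η : Fin S.m → ℝ) : ℝ :=
  (Matrix.trace (S.ρ η * M.op x)).re

/-- The partial derivative `∂p_x/∂θ_i` at the local point. -/
noncomputable def probDeriv (M : POVM S.d) (x : Fin M.n) (i : Fin S.m) : ℝ :=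
  lineDeriv ℝ (S.prob M x) S.θ (Pi.single i 1)

/-- The classical Fisher information matrix
`I(M)_{ij} = ∑_{x, p_x ≠ 0} (1/p_x) ∂_i p_x ∂_j p_x`. -/
noncomputable def cfim (M : POVM S.d) : Matrix (Fin S.m) (Fin S.m) ℝ :=
  Matrix.of fun i j =>
    ∑ x, if S.prob M x S.θ ≠ 0 then
      1 / S.prob M x S.θ * S.probDeriv M x i * S.probDeriv M x j else 0

open Classical in
/-- The weighted mean squared error `Tr(J I(M)⁻¹)`, which is `∞` if `I(M)` is singular (then
no estimator based on `M` is locally unbiased). -/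
noncomputable def weightedError (M : POVM S.d) : ℝ≥0∞ :=
  if (S.cfim M).PosDef then ENNReal.ofReal (Matrix.trace (S.qfim * (S.cfim M)⁻¹)) else ⊤

end ParamState

/-- Weak near-optimality of a family of pairs (parameterized state `S`, corresponding POVM `M`).
With constants `c₁, c₂ > 0` that are uniform over the family: `I(M)` is positive definite,
`Tr(J I(M)⁻¹) ≤ c₁ inf_N Tr(J I(N)⁻¹)` with the infimum over all POVMs `N`, and
`I(M) ⪰ c₂ (Tr(J⁻¹ I(M)) / m) J`. -/
def WeaklyNearOptimal (F : (S : ParamState) → POVM S.d → Prop) : Prop :=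
  ∃ c₁ c₂ : ℝ, 0 < c₁ ∧ 0 < c₂ ∧ ∀ (S : ParamState) (M : POVM S.d), F S M →
    (S.cfim M).PosDef ∧
    S.weightedError M ≤ ENNReal.ofReal c₁ * ⨅ N : POVM S.d, S.weightedError N ∧
    (S.cfim M -
      (c₂ * (Matrix.trace (S.qfim⁻¹ * S.cfim M) / (S.m : ℝ))) • S.qfim).PosSemidef

end QuantumMetrology

/-! Write r for the rank and, for a direction a, let D = ∑ a_i ∂_iρ. This is a traceless Hermitian
matrix, and since neighbouring states are positive it has no block on the kernel of ρ
(`dirDeriv_vanishesOnKernel`). Two bounds comparing Fisher information with J are combined.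

Lower bound for a 3-design: aᵀI(M)a is the sum of (Tr D M_s)² / Tr(ρ M_s). The convex function 1/p
lies above its tangents, so the sum is at least a combination of a second and a third moment, and
these agree with the Haar averages. For traceless D the average of ⟨D⟩²⟨B⟩ is (Tr D² Tr B + 2 Tr
D²B) / (d(d+1)(d+2)), and the best tangent yields aᵀI(M)a ≥ Tr D² / 3
(`POVM.IsThreeDesign.le_sum_sq_div`). On the other side aᵀJa = ∑ 2|D_jk|²/(λ_j+λ_k) ≤ 2κr Tr D²,
because conditioning keeps the nonzero eigenvalues above 1/(κr). Hence I(M) ⪰ J/(6κr)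
(`cfim_sub_smul_qfim_posSemidef`).

Upper bound for every POVM N, of Gill–Massar type: Tr(J⁻¹I(N)) splits into outcomes. Cauchy–Schwarz
in the metric J bounds the share of an outcome by its weight on the relevant subspace
(`sq_trace_le_of_block`, `sq_trace_le_of_offDiagonal`), and completeness of N sums these weights to
d-1, r-1 and d-r in the three cases. Each time r Tr(J⁻¹I(N)) ≤ m.

The upper bound forces Tr(J I(N)⁻¹) ≥ rm for all N with I(N) positive definite, while the lower
bound gives Tr(J I(M)⁻¹) ≤ 6κrm. Together they also give I(M) ⪰ J/(6κr) ⪰ (Tr(J⁻¹I(M))/(6κm)) J. -/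

namespace QuantumMetrology

/-! ### Isometry invariance of the Haar measure on the sphere -/

section Sphere

variable {d : ℕ}

/-- A linear isometry acting on the unit sphere. -/
noncomputable def sphereMap (f : EuclideanSpace ℂ (Fin d) ≃ₗᵢ[ℝ] EuclideanSpace ℂ (Fin d))
    (ψ : Metric.sphere (0 : EuclideanSpace ℂ (Fin d)) 1) :
    Metric.sphere (0 : EuclideanSpace ℂ (Fin d)) 1 :=
  ⟨f ψ, by simp⟩

theorem continuous_sphereMap (f : EuclideanSpace ℂ (Fin d) ≃ₗᵢ[ℝ] EuclideanSpace ℂ (Fin d)) :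
    Continuous (sphereMap f) :=
  (f.continuous.comp continuous_subtype_val).subtype_mk _

open scoped Pointwise in
-- `toSphere` measures a set by the volume of the cone over it; a linear isometry commutes with
-- taking cones and preserves volume.
theorem measurePreserving_sphereMap
    (f : EuclideanSpace ℂ (Fin d) ≃ₗᵢ[ℝ] EuclideanSpace ℂ (Fin d)) :
    MeasurePreserving (sphereMap f) (haarSphere d) (haarSphere d) := by
  have key : MeasurePreserving (sphereMap f)
      (volume : Measure (EuclideanSpace ℂ (Fin d))).toSphere
      (volume : Measure (EuclideanSpace ℂ (Fin d))).toSphere := by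
    refine ⟨(continuous_sphereMap f).measurable, ?_⟩
    ext s hs
    rw [Measure.map_apply (continuous_sphereMap f).measurable hs,
      Measure.toSphere_apply' _ hs,
      Measure.toSphere_apply' _ ((continuous_sphereMap f).measurable hs)]
    congr 1
    have hset : Set.Ioo (0 : ℝ) 1 • (Subtype.val '' (sphereMap f ⁻¹' s)) =
        f ⁻¹' (Set.Ioo (0 : ℝ) 1 • (Subtype.val '' s)) := by
      ext v
      simp only [Set.mem_smul, Set.mem_image, Set.mem_preimage]
      constructor
      · rintro ⟨t, ht, _, ⟨ψ, hψ, rfl⟩, rfl⟩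
        exact ⟨t, ht, _, ⟨_, hψ, rfl⟩, by simp [sphereMap]⟩
      · rintro ⟨t, ht, _, ⟨ψ, hψ, rfl⟩, h⟩
        refine ⟨t, ht, f.symm ψ, ⟨⟨f.symm ψ, by simp⟩, ?_, rfl⟩, ?_⟩
        · simpa [sphereMap] using hψ
        · apply f.injective
          simpa using h
    rw [hset]
    exact f.measurePreserving.measure_preimage_equiv (f := f.toMeasurableEquiv) _
  unfold haarSphere
  exact ⟨key.measurable, by rw [Measure.map_smul, key.map_eq]⟩

theorem integral_sphere_isometry
    (f : EuclideanSpace ℂ (Fin d) →ₗ[ℝ] EuclideanSpace ℂ (Fin d)) (hf : ∀ v, ‖f v‖ = ‖v‖)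
    {g : EuclideanSpace ℂ (Fin d) → ℂ} (hg : Continuous g) :
    ∫ ψ, g (f (ψ : EuclideanSpace ℂ (Fin d)))  ∂(haarSphere d) =
      ∫ ψ, g (ψ : EuclideanSpace ℂ (Fin d)) ∂(haarSphere d) := by
  let e : EuclideanSpace ℂ (Fin d) ≃ₗᵢ[ℝ] EuclideanSpace ℂ (Fin d) :=
    LinearIsometry.toLinearIsometryEquiv ⟨f, hf⟩ rfl
  have h := measurePreserving_sphereMap e
  conv_rhs => rw [← h.map_eq]
  exact (integral_map h.measurable.aemeasurable
    (f := fun ψ : Metric.sphere (0 : EuclideanSpace ℂ (Fin d)) 1 => g ψ)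
    (hg.comp continuous_subtype_val).aestronglyMeasurable).symm

instance (d : ℕ) : IsFiniteMeasure (haarSphere d) := by
  unfold haarSphere
  rcases eq_or_ne ((volume : Measure (EuclideanSpace ℂ (Fin d))).toSphere) 0 with h | h
  -- Only d = 0 leads here: the normalizing factor is 0⁻¹ = ∞, but it multiplies the zero measure.
  · rw [h]; simp only [smul_zero]; infer_instance
  · constructor
    rw [Measure.smul_apply, smul_eq_mul]
    exact ENNReal.mul_lt_top (ENNReal.inv_lt_top.2 (Measure.measure_univ_pos.2 h))
      (measure_lt_top _ _)

theorem isProbabilityMeasure_haarSphere [NeZero d] : IsProbabilityMeasure (haarSphere d) := by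
  have h : (volume : Measure (EuclideanSpace ℂ (Fin d))).toSphere ≠ 0 :=
    Measure.toSphere_ne_zero _
  constructor
  unfold haarSphere
  rw [Measure.smul_apply, smul_eq_mul]
  exact ENNReal.inv_mul_cancel (Measure.measure_univ_ne_zero.2 h) (measure_ne_top _ _)

theorem integrable_sphere {g : EuclideanSpace ℂ (Fin d) → ℂ} (hg : Continuous g) :
    Integrable (fun ψ : Metric.sphere (0 : EuclideanSpace ℂ (Fin d)) 1 => g ψ) (haarSphere d) :=
  (hg.comp continuous_subtype_val).integrable_of_hasCompactSupport
    (HasCompactSupport.of_compactSpace _)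

end Sphere

/-! ### Moments of the coordinates of a Haar random pure state -/

section Moments

variable {d : ℕ}

/-- The Haar average of a function on the unit sphere. -/
noncomputable def haarMean (g : EuclideanSpace ℂ (Fin d) → ℂ) : ℂ :=
  ∫ ψ, g (ψ : EuclideanSpace ℂ (Fin d)) ∂(haarSphere d)

theorem haarMean_add {g h : EuclideanSpace ℂ (Fin d) → ℂ} (hg : Continuous g)
    (hh : Continuous h) : haarMean (fun v => g v + h v) = haarMean g + haarMean h :=
  integral_add (integrable_sphere hg) (integrable_sphere hh)

theorem haarMean_const_mul (c : ℂ) (g : EuclideanSpace ℂ (Fin d) → ℂ) :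
    haarMean (fun v => c * g v) = c * haarMean g :=
  integral_const_mul _ _

theorem haarMean_sum {ι : Type*} (s : Finset ι) {g : ι → EuclideanSpace ℂ (Fin d) → ℂ}
    (hg : ∀ i, Continuous (g i)) :
    haarMean (fun v => ∑ i ∈ s, g i v) = ∑ i ∈ s, haarMean (g i) :=
  integral_finsetSum _ fun i _ => integrable_sphere (hg i)

theorem haarMean_isometry
    (f : EuclideanSpace ℂ (Fin d) →ₗ[ℝ] EuclideanSpace ℂ (Fin d)) (hf : ∀ v, ‖f v‖ = ‖v‖)
    {g : EuclideanSpace ℂ (Fin d) → ℂ} (hg : Continuous g) :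
    haarMean (fun v => g (f v)) = haarMean g :=
  integral_sphere_isometry f hf hg

theorem haarMean_congr_sphere {g h : EuclideanSpace ℂ (Fin d) → ℂ}
    (H : ∀ v, ‖v‖ = 1 → g v = h v) : haarMean g = haarMean h :=
  integral_congr_ae (Eventually.of_forall fun ψ => H ψ (by simp))

theorem haarMean_one [NeZero d] : haarMean (fun _ : EuclideanSpace ℂ (Fin d) => 1) = 1 := by
  have := isProbabilityMeasure_haarSphere (d := d)
  simp [haarMean]

/-- The squared modulus of a coordinate. -/
def weight (j : Fin d) (v : EuclideanSpace ℂ (Fin d)) : ℂ := v j * star (v j)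

@[fun_prop]
theorem continuous_weight (j : Fin d) : Continuous (weight j) := by
  unfold weight; fun_prop

theorem norm_eq_of_sum_eq {v w : EuclideanSpace ℂ (Fin d)}
    (h : ∑ i, ‖v i‖ ^ 2 = ∑ i, ‖w i‖ ^ 2) : ‖v‖ = ‖w‖ := by
  rw [EuclideanSpace.norm_eq, EuclideanSpace.norm_eq, h]

/-- The mixing of the coordinates `j` and `k` with phase `ω`. -/
noncomputable def mixLin (j k : Fin d) (ω : ℂ) :
    EuclideanSpace ℂ (Fin d) →ₗ[ℝ] EuclideanSpace ℂ (Fin d) where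
  toFun v := WithLp.toLp 2 fun i =>
    if i = j then (v j + ω * v k) / (√2 : ℝ) else if i = k then (v j - ω * v k) / (√2 : ℝ) else v i
  map_add' v w := by
    ext i
    simp only [PiLp.add_apply]
    split_ifs <;> ring
  map_smul' c v := by
    ext i
    simp only [PiLp.smul_apply, RingHom.id_apply, Complex.real_smul]
    split_ifs <;> ring

theorem sum_split_pair {M : Type*} [AddCommMonoid M] {j k : Fin d} (h : j ≠ k) (f : Fin d → M) :
    ∑ i, f i = f j + f k + ∑ i ∈ (Finset.univ.erase j).erase k, f i := by
  rw [← Finset.add_sum_erase _ f (Finset.mem_univ j),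
    ← Finset.add_sum_erase _ f (Finset.mem_erase.2 ⟨h.symm, Finset.mem_univ k⟩), add_assoc]

theorem norm_mixLin {j k : Fin d} (h : j ≠ k) {ω : ℂ} (hω : ω * star ω = 1)
    (v : EuclideanSpace ℂ (Fin d)) : ‖mixLin j k ω v‖ = ‖v‖ := by
  apply norm_eq_of_sum_eq
  rw [sum_split_pair h, sum_split_pair h (fun i => ‖v i‖ ^ 2)]
  congr 1
  · have h2 : ((√2 : ℝ) : ℂ) * (√2 : ℝ) = 2 := by norm_cast; norm_num
    have e1 : mixLin j k ω v j = (v j + ω * v k) / (√2 : ℝ) := by simp [mixLin]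
    have e2 : mixLin j k ω v k = (v j - ω * v k) / (√2 : ℝ) := by simp [mixLin, h.symm]
    rw [e1, e2, norm_div, norm_div, div_pow, div_pow]
    have p := parallelogram_law_with_norm ℝ (v j) (ω * v k)
    have hn : ‖ω‖ = 1 := by
      have : ‖ω‖ * ‖ω‖ = 1 := by
        have := congrArg norm hω
        simpa using this
      nlinarith [norm_nonneg ω]
    rw [norm_mul, hn] at p
    have : ‖((√2 : ℝ) : ℂ)‖ ^ 2 = 2 := by simp
    rw [this]
    linarith
  · refine Finset.sum_congr rfl fun i hi => ?_
    simp only [Finset.mem_erase] at hi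
    simp [mixLin, hi.1, hi.2.1]

/-- The permutation of the coordinates by `σ`. -/
noncomputable def permLin (σ : Equiv.Perm (Fin d)) :
    EuclideanSpace ℂ (Fin d) →ₗ[ℝ] EuclideanSpace ℂ (Fin d) where
  toFun v := WithLp.toLp 2 fun i => v (σ i)
  map_add' v w := by ext i; simp
  map_smul' c v := by ext i; simp

theorem norm_permLin (σ : Equiv.Perm (Fin d)) (v : EuclideanSpace ℂ (Fin d)) :
    ‖permLin σ v‖ = ‖v‖ := by
  apply norm_eq_of_sum_eq
  exact Equiv.sum_comp σ fun i => ‖v i‖ ^ 2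

/-- The change of sign of the coordinate `j`. -/
noncomputable def flipLin (j : Fin d) :
    EuclideanSpace ℂ (Fin d) →ₗ[ℝ] EuclideanSpace ℂ (Fin d) where
  toFun v := WithLp.toLp 2 fun i => if i = j then -v i else v i
  map_add' v w := by
    ext i
    simp only [PiLp.add_apply]
    split_ifs <;> ring
  map_smul' c v := by
    ext i
    simp only [PiLp.smul_apply, RingHom.id_apply, Complex.real_smul]
    split_ifs <;> ring

theorem norm_flipLin (j : Fin d) (v : EuclideanSpace ℂ (Fin d)) : ‖flipLin j v‖ = ‖v‖ := by
  apply norm_eq_of_sum_eq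
  refine Finset.sum_congr rfl fun i _ => ?_
  simp only [flipLin, LinearMap.coe_mk, AddHom.coe_mk]
  split_ifs <;> simp

/-- The action of a matrix. -/
noncomputable def matLin (W : Matrix (Fin d) (Fin d) ℂ) :
    EuclideanSpace ℂ (Fin d) →ₗ[ℝ] EuclideanSpace ℂ (Fin d) where
  toFun v := WithLp.toLp 2 (W *ᵥ v.ofLp)
  map_add' v w := by simp [Matrix.mulVec_add]
  map_smul' c v := by simp [Matrix.mulVec_smul]

theorem ketbra_eq_vecMulVec (v : EuclideanSpace ℂ (Fin d)) :
    ketbra v = vecMulVec v.ofLp (star v.ofLp) := rfl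

theorem ketbra_matLin (W : Matrix (Fin d) (Fin d) ℂ) (v : EuclideanSpace ℂ (Fin d)) :
    ketbra (matLin W v) = W * ketbra v * Wᴴ := by
  rw [ketbra_eq_vecMulVec, ketbra_eq_vecMulVec, Matrix.mul_vecMulVec, Matrix.vecMulVec_mul,
    ← Matrix.star_mulVec]
  rfl

theorem trace_ketbra (v : EuclideanSpace ℂ (Fin d)) : (ketbra v).trace = (‖v‖ ^ 2 : ℝ) := by
  rw [EuclideanSpace.norm_sq_eq]
  push_cast
  refine Finset.sum_congr rfl fun i _ => ?_
  simp only [ketbra, Matrix.diag_apply, Matrix.of_apply]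
  exact Complex.mul_conj' (v i)

theorem norm_matLin {W : Matrix (Fin d) (Fin d) ℂ} (hW : Wᴴ * W = 1)
    (v : EuclideanSpace ℂ (Fin d)) : ‖matLin W v‖ = ‖v‖ := by
  have h : (ketbra (matLin W v)).trace = (ketbra v).trace := by
    rw [ketbra_matLin, Matrix.trace_mul_comm, ← Matrix.mul_assoc, hW, Matrix.one_mul]
  rw [trace_ketbra, trace_ketbra, Complex.ofReal_inj] at h
  exact (sq_eq_sq₀ (norm_nonneg _) (norm_nonneg _)).1 h

theorem haarMean_odd (j : Fin d) {g : EuclideanSpace ℂ (Fin d) → ℂ} (hg : Continuous g)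
    (h : ∀ v, g (flipLin j v) = -g v) : haarMean g = 0 := by
  have := haarMean_isometry _ (norm_flipLin j) hg
  simp only [h] at this
  have h2 : haarMean (fun v => -g v) = -haarMean g := integral_neg _
  rw [h2] at this
  exact self_eq_neg.1 this.symm

/-- The third moments of the weights. -/
noncomputable def moment (j k l : Fin d) : ℂ :=
  haarMean fun v => weight j v * weight k v * weight l v

theorem moment_swap₁₂ (j k l : Fin d) : moment j k l = moment k j l := by
  unfold moment; congr 1; ext v; ring

theorem moment_swap₂₃ (j k l : Fin d) : moment j k l = moment j l k := by
  unfold moment; congr 1; ext v; ring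

theorem moment_perm (σ : Equiv.Perm (Fin d)) (j k l : Fin d) :
    moment (σ j) (σ k) (σ l) = moment j k l :=
  haarMean_isometry _ (norm_permLin σ) (g := fun v => weight j v * weight k v * weight l v)
    (by fun_prop)

theorem weight_mixLin_left {j k : Fin d} (ω : ℂ) (v : EuclideanSpace ℂ (Fin d)) :
    weight j (mixLin j k ω v) = (v j + ω * v k) * (star (v j) + star ω * star (v k)) / 2 := by
  have h2 : ((√2 : ℝ) : ℂ) * (√2 : ℝ) = 2 := by norm_cast; norm_num
  simp only [weight, mixLin, LinearMap.coe_mk, AddHom.coe_mk, if_true, star_div₀, star_add,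
    star_mul']
  rw [div_mul_div_comm]
  congr 1
  rw [← h2]; simp

theorem weight_mixLin_of_ne {j k l : Fin d} (hj : l ≠ j) (hk : l ≠ k) (ω : ℂ)
    (v : EuclideanSpace ℂ (Fin d)) : weight l (mixLin j k ω v) = weight l v := by
  simp [weight, mixLin, hj, hk]

/-- Summing over the fourth roots of unity removes all powers of the phase not divisible by 4. In
the polynomials used below the exponents lie between -3 and 3, so only the phase-free terms survive.
-/
theorem haarMean_mix {j k : Fin d} (h : j ≠ k) {g : EuclideanSpace ℂ (Fin d) → ℂ}
    (hg : Continuous g) :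
    4 * haarMean g = haarMean fun v => g (mixLin j k 1 v) + g (mixLin j k Complex.I v) +
      g (mixLin j k (-1) v) + g (mixLin j k (-Complex.I) v) := by
  have hc : ∀ ω, Continuous fun v => g (mixLin j k ω v) := fun ω =>
    hg.comp (mixLin j k ω).continuous_of_finiteDimensional
  have hi : ∀ ω : ℂ, ω * star ω = 1 → haarMean (fun v => g (mixLin j k ω v)) = haarMean g :=
    fun ω hω => haarMean_isometry _ (norm_mixLin h hω) hg
  have hc1 := hc 1
  have hc2 := hc Complex.I
  have hc3 := hc (-1)
  have hc4 := hc (-Complex.I)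
  rw [haarMean_add (by fun_prop) (by fun_prop), haarMean_add (by fun_prop) (by fun_prop),
    haarMean_add (by fun_prop) (by fun_prop), hi 1 (by simp),
    hi Complex.I (by simp), hi (-1) (by simp), hi (-Complex.I) (by simp)]
  ring

/-- The phase average of |v_j + ωv_k|⁶/8 is (|v_j|⁶ + 9|v_j|⁴|v_k|² + 9|v_j|²|v_k|⁴ + |v_k|⁶)/8; the
symmetry j ↔ k turns this into a linear equation between two moments. -/
theorem moment_cube {j k : Fin d} (h : j ≠ k) : moment j j j = 3 * moment j j k := by
  have e := haarMean_mix h (g := fun v => weight j v * weight j v * weight j v) (by fun_prop)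
  have e2 : (fun v : EuclideanSpace ℂ (Fin d) =>
      weight j (mixLin j k 1 v) * weight j (mixLin j k 1 v) * weight j (mixLin j k 1 v) +
      weight j (mixLin j k Complex.I v) * weight j (mixLin j k Complex.I v) *
        weight j (mixLin j k Complex.I v) +
      weight j (mixLin j k (-1) v) * weight j (mixLin j k (-1) v) * weight j (mixLin j k (-1) v) +
      weight j (mixLin j k (-Complex.I) v) * weight j (mixLin j k (-Complex.I) v) *
        weight j (mixLin j k (-Complex.I) v)) = fun v =>
      ((1 / 2) * (weight j v * weight j v * weight j v) +
      (1 / 2) * (weight k v * weight k v * weight k v)) +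
      ((9 / 2) * (weight j v * weight j v * weight k v) +
      (9 / 2) * (weight k v * weight k v * weight j v)) := by
    ext v
    simp only [weight_mixLin_left]
    simp only [weight]
    have hI : star Complex.I = -Complex.I := Complex.conj_I
    simp only [star_neg, hI, star_one]
    have := Complex.I_sq
    grind
  rw [e2, haarMean_add (by fun_prop) (by fun_prop), haarMean_add (by fun_prop) (by fun_prop),
    haarMean_add (by fun_prop) (by fun_prop), haarMean_const_mul, haarMean_const_mul,
    haarMean_const_mul, haarMean_const_mul] at e
  change 4 * moment j j j = 1 / 2 * moment j j j + 1 / 2 * moment k k k +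
    (9 / 2 * moment j j k + 9 / 2 * moment k k j) at e
  have s1 := moment_perm (Equiv.swap j k) j j j
  have s2 := moment_perm (Equiv.swap j k) j j k
  rw [Equiv.swap_apply_left] at s1 s2
  rw [Equiv.swap_apply_right] at s2
  rw [s1, s2] at e
  linear_combination e / 3

theorem moment_sq {j k l : Fin d} (h : j ≠ k) (hj : l ≠ j) (hk : l ≠ k) :
    moment j j l = 2 * moment j k l := by
  have e := haarMean_mix h (g := fun v => weight j v * weight j v * weight l v) (by fun_prop)
  have e2 : (fun v : EuclideanSpace ℂ (Fin d) =>
      weight j (mixLin j k 1 v) * weight j (mixLin j k 1 v) * weight l (mixLin j k 1 v) +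
      weight j (mixLin j k Complex.I v) * weight j (mixLin j k Complex.I v) *
        weight l (mixLin j k Complex.I v) +
      weight j (mixLin j k (-1) v) * weight j (mixLin j k (-1) v) * weight l (mixLin j k (-1) v) +
      weight j (mixLin j k (-Complex.I) v) * weight j (mixLin j k (-Complex.I) v) *
        weight l (mixLin j k (-Complex.I) v)) = fun v =>
      (weight j v * weight j v * weight l v + weight k v * weight k v * weight l v) +
      4 * (weight j v * weight k v * weight l v) := by
    ext v
    simp only [weight_mixLin_of_ne hj hk]
    simp only [weight_mixLin_left]
    simp only [weight]
    have hI : star Complex.I = -Complex.I := Complex.conj_I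
    simp only [star_neg, hI, star_one]
    have := Complex.I_sq
    grind
  rw [e2, haarMean_add (by fun_prop) (by fun_prop), haarMean_add (by fun_prop) (by fun_prop),
    haarMean_const_mul] at e
  change 4 * moment j j l = moment j j l + moment k k l + 4 * moment j k l at e
  have s1 := moment_perm (Equiv.swap j k) j j l
  rw [Equiv.swap_apply_left, Equiv.swap_apply_of_ne_of_ne hj hk] at s1
  rw [s1] at e
  linear_combination e / 2

/-- Third moments of the weights, up to a common factor. -/
theorem exists_moment_eq (d : ℕ) : ∃ c : ℂ, ∀ j k l : Fin d,
    moment j k l = c * (1 + (if j = k then 1 else 0) + (if j = l then 1 else 0) +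
      (if k = l then 1 else 0) + 2 * (if j = k then if k = l then 1 else 0 else 0)) := by
  rcases d with _ | d
  · exact ⟨0, fun j => j.elim0⟩
  -- The bracket counts the permutations of three positions that fix (j, k, l): 6, 2 or 1 according
  -- to whether three, two or no indices agree.
  refine ⟨moment (0 : Fin (d + 1)) 0 0 / 6, ?_⟩
  have h1 : ∀ j : Fin (d + 1), moment j j j = moment (0 : Fin (d + 1)) 0 0 := fun j => by
    have := moment_perm (Equiv.swap 0 j) (0 : Fin (d + 1)) 0 0
    rwa [Equiv.swap_apply_left] at this
  have h2 : ∀ j k : Fin (d + 1), j ≠ k → moment j j k = moment (0 : Fin (d + 1)) 0 0 / 3 := fun j k h => by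
    rw [← h1 j, moment_cube h]; ring
  intro j k l
  by_cases hjk : j = k
  · subst hjk
    by_cases hjl : j = l
    · subst hjl
      rw [h1]; simp; ring
    · rw [h2 j l hjl]; simp [hjl]; ring
  · by_cases hjl : j = l
    · subst hjl
      rw [moment_swap₂₃, h2 j k hjk]; simp [hjk, Ne.symm hjk]; ring
    · by_cases hkl : k = l
      · subst hkl
        rw [moment_swap₁₂, moment_swap₂₃, h2 k j (Ne.symm hjk)]; simp [hjk]; ring
      · have := moment_sq hjk (Ne.symm hjl) (Ne.symm hkl)
        rw [h2 j l hjl] at this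
        simp [hjk, hjl, hkl]
        linear_combination -this / 2

end Moments

/-! ### Third moments of quadratic forms and `3`-designs -/

section Forms

variable {d : ℕ}

/-- The quadratic form `⟨v|A|v⟩`. -/
noncomputable def expect (A : Matrix (Fin d) (Fin d) ℂ) (v : EuclideanSpace ℂ (Fin d)) : ℂ :=
  (A * ketbra v).trace

theorem expect_eq_sum (A : Matrix (Fin d) (Fin d) ℂ) (v : EuclideanSpace ℂ (Fin d)) :
    expect A v = ∑ a, ∑ b, A a b * (v b * star (v a)) := by
  simp [expect, Matrix.trace, Matrix.mul_apply, ketbra]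

@[fun_prop]
theorem continuous_expect (A : Matrix (Fin d) (Fin d) ℂ) : Continuous (expect A) := by
  rw [funext (expect_eq_sum A)]
  fun_prop

theorem expect_diagonal (x : Fin d → ℂ) (v : EuclideanSpace ℂ (Fin d)) :
    expect (diagonal x) v = ∑ j, x j * weight j v := by
  simp [expect_eq_sum, diagonal_apply, weight]

theorem expect_one (v : EuclideanSpace ℂ (Fin d)) : expect 1 v = (‖v‖ ^ 2 : ℝ) := by
  rw [expect, Matrix.one_mul, trace_ketbra]

theorem expect_matLin (W A : Matrix (Fin d) (Fin d) ℂ) (v : EuclideanSpace ℂ (Fin d)) :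
    expect A (matLin W v) = expect (Wᴴ * A * W) v := by
  rw [expect, expect, ketbra_matLin, ← Matrix.mul_assoc, Matrix.trace_mul_comm]
  simp only [Matrix.mul_assoc]

/-- An off-diagonal entry of B multiplies a function that is odd under a sign change of one
coordinate, so it averages to zero. -/
theorem haarMean_weight_mul_expect (j k : Fin d) (B : Matrix (Fin d) (Fin d) ℂ) :
    haarMean (fun v => weight j v * weight k v * expect B v) = ∑ l, B l l * moment j k l := by
  have h1 : (fun v : EuclideanSpace ℂ (Fin d) => weight j v * weight k v * expect B v) =
      fun v => ∑ a, ∑ b, B a b * (weight j v * weight k v * (v b * star (v a))) := by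
    ext v
    rw [expect_eq_sum, Finset.mul_sum]
    refine Finset.sum_congr rfl fun a _ => ?_
    rw [Finset.mul_sum]
    exact Finset.sum_congr rfl fun b _ => by ring
  rw [h1, haarMean_sum _ (fun a => by fun_prop)]
  refine Finset.sum_congr rfl fun a _ => ?_
  rw [haarMean_sum _ (fun b => by fun_prop), Finset.sum_eq_single a]
  · rw [haarMean_const_mul]; rfl
  · intro b _ hb
    rw [haarMean_const_mul, haarMean_odd a, mul_zero]
    · fun_prop
    · intro v
      have hw : ∀ i, weight i (flipLin a v) = weight i v := fun i => by
        simp only [weight, flipLin, LinearMap.coe_mk, AddHom.coe_mk]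
        split_ifs <;> simp
      rw [hw, hw]
      simp [flipLin, hb]
  · simp

theorem haarMean_diagonal (x : Fin d → ℂ) (B : Matrix (Fin d) (Fin d) ℂ) :
    haarMean (fun v => expect (diagonal x) v * expect (diagonal x) v * expect B v) =
      ∑ j, ∑ k, ∑ l, x j * x k * B l l * moment j k l := by
  have h1 : (fun v : EuclideanSpace ℂ (Fin d) =>
      expect (diagonal x) v * expect (diagonal x) v * expect B v) =
      fun v => ∑ j, ∑ k, (x j * x k) * (weight j v * weight k v * expect B v) := by
    ext v
    rw [expect_diagonal, Finset.sum_mul_sum, Finset.sum_mul]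
    refine Finset.sum_congr rfl fun a _ => ?_
    rw [Finset.sum_mul]
    exact Finset.sum_congr rfl fun b _ => by ring
  rw [h1, haarMean_sum _ (fun a => by fun_prop)]
  refine Finset.sum_congr rfl fun a _ => ?_
  rw [haarMean_sum _ (fun a => by fun_prop)]
  refine Finset.sum_congr rfl fun b _ => ?_
  rw [haarMean_const_mul, haarMean_weight_mul_expect, Finset.mul_sum]
  exact Finset.sum_congr rfl fun _ _ => by ring

/-- The summands on the right come from the identity, the transposition of the two x-slots, the two
other transpositions and the two 3-cycles. -/
theorem sum_moment_pattern (c : ℂ) (x y : Fin d → ℂ) :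
    ∑ j, ∑ k, ∑ l, x j * x k * y l *
      (c * (1 + (if j = k then 1 else 0) + (if j = l then 1 else 0) +
      (if k = l then 1 else 0) + 2 * (if j = k then if k = l then 1 else 0 else 0))) =
    c * ((∑ j, x j) ^ 2 * (∑ l, y l) + (∑ j, x j * x j) * (∑ l, y l) +
      2 * (∑ j, x j) * (∑ j, x j * y j) + 2 * ∑ j, x j * x j * y j) := by
  have e : ∀ j k l : Fin d, x j * x k * y l *
      (c * (1 + (if j = k then 1 else 0) + (if j = l then 1 else 0) +
      (if k = l then 1 else 0) + 2 * (if j = k then if k = l then 1 else 0 else 0))) =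
      c * (x j * (x k * y l)) + (if j = k then c * (x j * x k * y l) else 0) +
      (if j = l then c * (x k * (x j * y l)) else 0) +
      (if k = l then c * (x j * (x k * y l)) else 0) +
      (if k = l then if j = k then 2 * c * (x j * x k * y l) else 0 else 0) := by
    intro j k l
    split_ifs <;> ring
  simp only [e, Finset.sum_add_distrib, Finset.sum_ite_eq, Finset.mem_univ, if_true]
  have e3 : ∑ j, ∑ k, ∑ l, (if j = k then c * (x j * x k * y l) else 0) =
      c * ((∑ j, x j * x j) * ∑ l, y l) := by
    rw [Finset.sum_mul, Finset.mul_sum]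
    refine Finset.sum_congr rfl fun j _ => ?_
    rw [Finset.sum_comm]
    simp only [Finset.sum_ite_eq, Finset.mem_univ, if_true]
    rw [← Finset.mul_sum, ← Finset.mul_sum]
  rw [e3]
  simp only [← Finset.mul_sum, ← Finset.sum_mul]
  ring

/-- Unitary invariance reduces to diagonal D, where the moments of the weights suffice;
tracelessness removes the terms containing Tr D. -/
theorem exists_haarMean_expect (d : ℕ) [NeZero d] : ∃ c : ℂ, c * (d * (d + 1) * (d + 2)) = 1 ∧
    ∀ D B : Matrix (Fin d) (Fin d) ℂ, D.IsHermitian → D.trace = 0 →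
      haarMean (fun v => expect D v * expect D v * expect B v) =
        c * ((D * D).trace * B.trace + 2 * (D * D * B).trace) := by
  obtain ⟨c, hc⟩ := exists_moment_eq d
  have main : ∀ (x : Fin d → ℂ) (B : Matrix (Fin d) (Fin d) ℂ),
      haarMean (fun v => expect (diagonal x) v * expect (diagonal x) v * expect B v) =
      c * ((∑ j, x j) ^ 2 * (∑ l, B l l) + (∑ j, x j * x j) * (∑ l, B l l) +
      2 * (∑ j, x j) * (∑ j, x j * B j j) + 2 * ∑ j, x j * x j * B j j) := by
    intro x B
    rw [haarMean_diagonal, ← sum_moment_pattern]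
    simp only [hc]
  refine ⟨c, ?_, ?_⟩
  -- Taking all three forms to be the identity fixes the normalization of c.
  · have h := main (fun _ => 1) 1
    rw [haarMean_congr_sphere (h := fun _ => 1), haarMean_one] at h
    · simp at h
      linear_combination -h
    · intro v hv
      have : diagonal (fun _ : Fin d => (1 : ℂ)) = 1 := diagonal_one
      rw [this, expect_one, hv]; simp
  · intro D B hD htr
    set W : Matrix (Fin d) (Fin d) ℂ := hD.eigenvectorUnitary.1 with hWdef
    have hW : Wᴴ * W = 1 := Unitary.coe_star_mul_self hD.eigenvectorUnitary
    have hW' : W * Wᴴ = 1 := Unitary.coe_mul_star_self hD.eigenvectorUnitary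
    set x : Fin d → ℂ := fun j => (hD.eigenvalues j : ℂ)
    have hspec : D = W * diagonal x * Wᴴ := by
      have := hD.spectral_theorem
      rwa [Unitary.conjStarAlgAut_apply] at this
    have hdiag : Wᴴ * D * W = diagonal x := by
      rw [hspec]
      calc Wᴴ * (W * diagonal x * Wᴴ) * W = (Wᴴ * W) * diagonal x * (Wᴴ * W) := by
            simp only [Matrix.mul_assoc]
        _ = _ := by rw [hW]; simp
    have htr' : ∑ j, x j = 0 := by
      rw [← htr, ← trace_diagonal, ← hdiag, Matrix.trace_mul_comm, ← Matrix.mul_assoc, hW',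
        Matrix.one_mul]
    have hDD : D * D = W * diagonal (fun j => x j * x j) * Wᴴ := by
      rw [← diagonal_mul_diagonal]
      nth_rw 1 2 [hspec]
      calc W * diagonal x * Wᴴ * (W * diagonal x * Wᴴ)
          = W * diagonal x * (Wᴴ * W) * diagonal x * Wᴴ := by simp only [Matrix.mul_assoc]
        _ = _ := by rw [hW]; simp only [Matrix.mul_assoc, Matrix.one_mul]
    rw [← haarMean_isometry _ (norm_matLin hW) (by fun_prop)]
    simp only [expect_matLin, hdiag]
    rw [main, htr']
    have t1 : (D * D).trace = ∑ j, x j * x j := by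
      rw [hDD, Matrix.trace_mul_comm, ← Matrix.mul_assoc, hW, Matrix.one_mul, trace_diagonal]
    have t2 : B.trace = ∑ l, (Wᴴ * B * W) l l := by
      change _ = (Wᴴ * B * W).trace
      rw [Matrix.trace_mul_comm, ← Matrix.mul_assoc, hW', Matrix.one_mul]
    have t3 : (D * D * B).trace = ∑ j, x j * x j * (Wᴴ * B * W) j j := by
      have : (D * D * B).trace = (diagonal (fun j => x j * x j) * (Wᴴ * B * W)).trace := by
        rw [hDD, Matrix.mul_assoc, Matrix.mul_assoc, Matrix.trace_mul_comm]
        simp only [Matrix.mul_assoc]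
      rw [this]
      simp [Matrix.trace, Matrix.diagonal_mul]
    rw [t1, t2, t3]
    ring

theorem trace_mul_tensorCube (A B C K : Matrix (Fin d) (Fin d) ℂ) :
    ((A ⊗ₖ (B ⊗ₖ C)) * tensorCube K).trace = (A * K).trace * (B * K).trace * (C * K).trace := by
  rw [tensorCube, ← Matrix.mul_kronecker_mul, ← Matrix.mul_kronecker_mul, Matrix.trace_kronecker,
    Matrix.trace_kronecker, mul_assoc]

theorem trace_mul_haarThirdMoment
    (K : Matrix (Fin d × Fin d × Fin d) (Fin d × Fin d × Fin d) ℂ) :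
    (K * haarThirdMoment d).trace = haarMean fun v => (K * tensorCube (ketbra v)).trace := by
  have hcont : ∀ a b, Continuous fun w : EuclideanSpace ℂ (Fin d) =>
      K b a * tensorCube (ketbra w) a b := by
    intro a b
    simp only [tensorCube, ketbra, kroneckerMap_apply, Matrix.of_apply]
    fun_prop
  simp only [Matrix.trace, Matrix.diag_apply, Matrix.mul_apply]
  rw [haarMean_sum _ (fun i => continuous_finsetSum _ fun j _ => hcont j i)]
  refine Finset.sum_congr rfl fun i _ => ?_
  rw [haarMean_sum _ (fun j => hcont j i)]
  refine Finset.sum_congr rfl fun j _ => ?_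
  rw [haarMean_const_mul]
  rfl

/-- Pair the design identity with A ⊗ B ⊗ C; the trace factorizes on each product state. -/
theorem IsProjectiveThreeDesign.sum_expect {n : ℕ} {q : Fin n → ℝ}
    {v : Fin n → EuclideanSpace ℂ (Fin d)} (h : IsProjectiveThreeDesign q v)
    (A B C : Matrix (Fin d) (Fin d) ℂ) :
    ∑ s, (q s : ℂ) * (expect A (v s) * expect B (v s) * expect C (v s)) =
      haarMean fun v => expect A v * expect B v * expect C v := by
  have h1 := congrArg (fun T => ((A ⊗ₖ (B ⊗ₖ C)) * T).trace) h
  simp only [Matrix.mul_sum, Matrix.trace_sum, Matrix.mul_smul, Matrix.trace_smul,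
    trace_mul_tensorCube, smul_eq_mul] at h1
  simp only [expect]
  rw [h1, trace_mul_haarThirdMoment]
  simp only [trace_mul_tensorCube]

end Forms

/-! ### Matrices in the eigenbasis of the state -/

section Eigenbasis

variable {d : ℕ} {ρ : Matrix (Fin d) (Fin d) ℂ} (hρ : ρ.IsHermitian)

/-- The matrix elements `⟨ψ_j|A|ψ_k⟩` in the eigenbasis of `ρ`. -/
noncomputable def inEigenbasis (A : Matrix (Fin d) (Fin d) ℂ) : Matrix (Fin d) (Fin d) ℂ :=
  (hρ.eigenvectorUnitary : Matrix (Fin d) (Fin d) ℂ)ᴴ * A *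
    (hρ.eigenvectorUnitary : Matrix (Fin d) (Fin d) ℂ)

theorem eigenvectorUnitary_star_mul :
    (hρ.eigenvectorUnitary : Matrix (Fin d) (Fin d) ℂ)ᴴ *
      (hρ.eigenvectorUnitary : Matrix (Fin d) (Fin d) ℂ) = 1 :=
  Unitary.coe_star_mul_self hρ.eigenvectorUnitary

theorem eigenvectorUnitary_mul_star :
    (hρ.eigenvectorUnitary : Matrix (Fin d) (Fin d) ℂ) *
      (hρ.eigenvectorUnitary : Matrix (Fin d) (Fin d) ℂ)ᴴ = 1 :=
  Unitary.coe_mul_star_self hρ.eigenvectorUnitary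

theorem inEigenbasis_conj (A : Matrix (Fin d) (Fin d) ℂ) :
    inEigenbasis hρ ((hρ.eigenvectorUnitary : Matrix (Fin d) (Fin d) ℂ) * A *
      (hρ.eigenvectorUnitary : Matrix (Fin d) (Fin d) ℂ)ᴴ) = A := by
  have h := eigenvectorUnitary_star_mul hρ
  unfold inEigenbasis
  set U := (hρ.eigenvectorUnitary : Matrix (Fin d) (Fin d) ℂ)
  calc Uᴴ * (U * A * Uᴴ) * U = (Uᴴ * U) * A * (Uᴴ * U) := by simp only [Matrix.mul_assoc]
    _ = A := by rw [h]; simp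

theorem eq_conj_inEigenbasis (A : Matrix (Fin d) (Fin d) ℂ) :
    (hρ.eigenvectorUnitary : Matrix (Fin d) (Fin d) ℂ) * inEigenbasis hρ A *
      (hρ.eigenvectorUnitary : Matrix (Fin d) (Fin d) ℂ)ᴴ = A := by
  have h := eigenvectorUnitary_mul_star hρ
  unfold inEigenbasis
  set U := (hρ.eigenvectorUnitary : Matrix (Fin d) (Fin d) ℂ)
  calc U * (Uᴴ * A * U) * Uᴴ = (U * Uᴴ) * A * (U * Uᴴ) := by simp only [Matrix.mul_assoc]
    _ = A := by rw [h]; simp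

theorem inEigenbasis_mul (A B : Matrix (Fin d) (Fin d) ℂ) :
    inEigenbasis hρ (A * B) = inEigenbasis hρ A * inEigenbasis hρ B := by
  have h := eigenvectorUnitary_mul_star hρ
  unfold inEigenbasis
  set U := (hρ.eigenvectorUnitary : Matrix (Fin d) (Fin d) ℂ)
  calc Uᴴ * (A * B) * U = Uᴴ * A * 1 * B * U := by simp [Matrix.mul_assoc]
    _ = _ := by rw [← h]; simp only [Matrix.mul_assoc]

theorem trace_inEigenbasis (A : Matrix (Fin d) (Fin d) ℂ) :
    (inEigenbasis hρ A).trace = A.trace := by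
  rw [inEigenbasis, Matrix.trace_mul_comm, ← Matrix.mul_assoc, eigenvectorUnitary_mul_star,
    Matrix.one_mul]

theorem trace_mul_eq_sum (A B : Matrix (Fin d) (Fin d) ℂ) :
    (A * B).trace = ∑ j, ∑ k, inEigenbasis hρ A j k * inEigenbasis hρ B k j := by
  rw [← trace_inEigenbasis hρ, inEigenbasis_mul]
  simp [Matrix.trace, Matrix.mul_apply]

theorem inEigenbasis_self :
    inEigenbasis hρ ρ = diagonal fun j => (hρ.eigenvalues j : ℂ) := by
  have := hρ.spectral_theorem
  rw [Unitary.conjStarAlgAut_apply] at this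
  exact (congrArg (inEigenbasis hρ) this).trans (inEigenbasis_conj hρ _)

theorem inEigenbasis_one : inEigenbasis hρ 1 = 1 := by
  rw [inEigenbasis, Matrix.mul_one, eigenvectorUnitary_star_mul]

theorem inEigenbasis_sum {ι : Type*} (s : Finset ι) (A : ι → Matrix (Fin d) (Fin d) ℂ) :
    inEigenbasis hρ (∑ i ∈ s, A i) = ∑ i ∈ s, inEigenbasis hρ (A i) := by
  simp [inEigenbasis, Matrix.mul_sum, Matrix.sum_mul]

theorem inEigenbasis_smul (a : ℝ) (A : Matrix (Fin d) (Fin d) ℂ) :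
    inEigenbasis hρ (a • A) = a • inEigenbasis hρ A := by
  simp [inEigenbasis]

theorem inEigenbasis_injective : Function.Injective (inEigenbasis hρ) := fun A B h => by
  rw [← eq_conj_inEigenbasis hρ A, h, eq_conj_inEigenbasis]

theorem inEigenbasis_isHermitian {A : Matrix (Fin d) (Fin d) ℂ} (hA : A.IsHermitian) :
    (inEigenbasis hρ A).IsHermitian :=
  isHermitian_conjTranspose_mul_mul _ hA

theorem inEigenbasis_posSemidef {A : Matrix (Fin d) (Fin d) ℂ} (hA : A.PosSemidef) :
    (inEigenbasis hρ A).PosSemidef :=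
  hA.conjTranspose_mul_mul_same _

theorem inEigenbasis_supportProj : inEigenbasis hρ (supportProj hρ) =
    diagonal fun k => if 0 < hρ.eigenvalues k then (1 : ℂ) else 0 :=
  inEigenbasis_conj hρ _

theorem inEigenbasis_sld (D : Matrix (Fin d) (Fin d) ℂ) : inEigenbasis hρ (sld hρ D) =
    Matrix.of fun j k =>
      if 0 < hρ.eigenvalues j + hρ.eigenvalues k then
        2 * inEigenbasis hρ D j k / ((hρ.eigenvalues j + hρ.eigenvalues k : ℝ) : ℂ)
      else 0 :=
  inEigenbasis_conj hρ _

theorem sld_sum_smul {m : ℕ} (a : Fin m → ℝ) (D : Fin m → Matrix (Fin d) (Fin d) ℂ) :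
    sld hρ (∑ i, a i • D i) = ∑ i, a i • sld hρ (D i) := by
  apply inEigenbasis_injective hρ
  rw [inEigenbasis_sld, inEigenbasis_sum, inEigenbasis_sum]
  ext j k
  simp only [inEigenbasis_smul, inEigenbasis_sld, Matrix.of_apply, Matrix.sum_apply,
    Matrix.smul_apply]
  split_ifs
  · rw [Finset.mul_sum, Finset.sum_div]
    refine Finset.sum_congr rfl fun i _ => ?_
    simp only [Complex.real_smul]
    ring
  · simp

/-- The squared norm `Tr(ρ L²)` of the derivative `D` in the metric of the quantum Fisher
information, `L` being the symmetric logarithmic derivative of `D`. -/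
noncomputable def sldNormSq (D : Matrix (Fin d) (Fin d) ℂ) : ℝ :=
  ∑ j, ∑ k, if 0 < hρ.eigenvalues j + hρ.eigenvalues k then
    2 * ‖inEigenbasis hρ D j k‖ ^ 2 / (hρ.eigenvalues j + hρ.eigenvalues k) else 0

theorem apply_mul_apply_of_isHermitian {A : Matrix (Fin d) (Fin d) ℂ} (hA : A.IsHermitian)
    (j k : Fin d) : A j k * A k j = (‖A j k‖ ^ 2 : ℝ) := by
  rw [← hA.apply k j, Complex.ofReal_pow]
  exact Complex.mul_conj' _

theorem norm_apply_comm {A : Matrix (Fin d) (Fin d) ℂ} (hA : A.IsHermitian)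
    (j k : Fin d) : ‖A j k‖ = ‖A k j‖ := by
  rw [← hA.apply k j, norm_star]

/-- The trace carries the weight λ_j/(λ_j+λ_k)²; since |D_jk| is symmetric, λ_j may be replaced by
(λ_j+λ_k)/2. -/
theorem trace_state_mul_sld_sq {D : Matrix (Fin d) (Fin d) ℂ} (hD : D.IsHermitian) :
    (ρ * (sld hρ D * sld hρ D)).trace.re = sldNormSq hρ D := by
  have hD' := inEigenbasis_isHermitian hρ hD
  set lam := hρ.eigenvalues with hlam
  have h1 : (ρ * (sld hρ D * sld hρ D)).trace = ((∑ j, ∑ k, if 0 < lam j + lam k then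
      lam j * (4 * ‖inEigenbasis hρ D j k‖ ^ 2 / (lam j + lam k) ^ 2) else 0 : ℝ) : ℂ) := by
    rw [← trace_inEigenbasis hρ, inEigenbasis_mul, inEigenbasis_mul, inEigenbasis_self,
      inEigenbasis_sld]
    simp only [Matrix.trace, Matrix.diag_apply, Matrix.diagonal_mul]
    push_cast
    refine Finset.sum_congr rfl fun j _ => ?_
    rw [Matrix.mul_apply, Finset.mul_sum]
    refine Finset.sum_congr rfl fun k _ => ?_
    simp only [Matrix.of_apply, ← hlam, add_comm (lam k) (lam j)]
    split_ifs with h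
    · have := apply_mul_apply_of_isHermitian hD' j k
      push_cast at this ⊢
      rw [← this]
      field_simp
      ring
    · simp
  rw [h1, Complex.ofReal_re]
  have h2 : ∑ j, ∑ k, (if 0 < lam j + lam k then
      lam j * (4 * ‖inEigenbasis hρ D j k‖ ^ 2 / (lam j + lam k) ^ 2) else 0) =
      ∑ j, ∑ k, (if 0 < lam j + lam k then
      lam k * (4 * ‖inEigenbasis hρ D j k‖ ^ 2 / (lam j + lam k) ^ 2) else 0) := by
    rw [Finset.sum_comm]
    simp only [norm_apply_comm hD' _ _, add_comm]
  have h3 : sldNormSq hρ D = (1 / 2) * (∑ j, ∑ k, (if 0 < lam j + lam k then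
      lam j * (4 * ‖inEigenbasis hρ D j k‖ ^ 2 / (lam j + lam k) ^ 2) else 0) +
      ∑ j, ∑ k, (if 0 < lam j + lam k then
      lam k * (4 * ‖inEigenbasis hρ D j k‖ ^ 2 / (lam j + lam k) ^ 2) else 0)) := by
    rw [← Finset.sum_add_distrib, Finset.mul_sum]
    refine Finset.sum_congr rfl fun j _ => ?_
    rw [← Finset.sum_add_distrib, Finset.mul_sum]
    refine Finset.sum_congr rfl fun k _ => ?_
    rw [← hlam]
    split_ifs with h
    · field_simp
      ring
    · simp
  rw [h3, ← h2]
  ring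

theorem qfimOf_transpose {m : ℕ} (D : Fin m → Matrix (Fin d) (Fin d) ℂ) :
    (qfimOf hρ D)ᵀ = qfimOf hρ D := by
  ext i j
  simp only [qfimOf, Matrix.transpose_apply, Matrix.of_apply]
  rw [add_comm]

theorem dotProduct_qfimOf_mulVec {m : ℕ} {D : Fin m → Matrix (Fin d) (Fin d) ℂ}
    (hD : ∀ i, (D i).IsHermitian) (a : Fin m → ℝ) :
    a ⬝ᵥ (qfimOf hρ D *ᵥ a) = sldNormSq hρ (∑ i, a i • D i) := by
  have hsum : (∑ i, a i • D i).IsHermitian := by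
    unfold Matrix.IsHermitian
    rw [Matrix.conjTranspose_sum]
    refine Finset.sum_congr rfl fun i _ => ?_
    rw [Matrix.conjTranspose_smul, (hD i).eq]; simp
  rw [← trace_state_mul_sld_sq hρ hsum, sld_sum_smul]
  have h1 : ∀ i j, qfimOf hρ D i j = (1 / 2) * ((ρ * (sld hρ (D i) * sld hρ (D j))).trace.re +
      (ρ * (sld hρ (D j) * sld hρ (D i))).trace.re) := by
    intro i j
    simp only [qfimOf, Matrix.of_apply, Matrix.mul_add, Matrix.trace_add, Complex.add_re]
  have h2 : (ρ * ((∑ i, a i • sld hρ (D i)) * ∑ i, a i • sld hρ (D i))).trace.re =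
      ∑ i, ∑ j, a i * a j * (ρ * (sld hρ (D i) * sld hρ (D j))).trace.re := by
    rw [Finset.sum_mul_sum, Matrix.mul_sum, Matrix.trace_sum, Complex.re_sum]
    refine Finset.sum_congr rfl fun i _ => ?_
    rw [Matrix.mul_sum, Matrix.trace_sum, Complex.re_sum]
    refine Finset.sum_congr rfl fun j _ => ?_
    simp [mul_assoc]
    ring
  have h3 : ∑ i, ∑ j, a i * a j * (ρ * (sld hρ (D j) * sld hρ (D i))).trace.re =
      ∑ i, ∑ j, a i * a j * (ρ * (sld hρ (D i) * sld hρ (D j))).trace.re := by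
    rw [Finset.sum_comm]
    exact Finset.sum_congr rfl fun i _ => Finset.sum_congr rfl fun j _ => by ring
  rw [h2]
  have h4 : a ⬝ᵥ (qfimOf hρ D *ᵥ a) = (1 / 2) *
      (∑ i, ∑ j, a i * a j * (ρ * (sld hρ (D i) * sld hρ (D j))).trace.re +
      ∑ i, ∑ j, a i * a j * (ρ * (sld hρ (D j) * sld hρ (D i))).trace.re) := by
    rw [← Finset.sum_add_distrib, Finset.mul_sum]
    refine Finset.sum_congr rfl fun i _ => ?_
    rw [← Finset.sum_add_distrib, Finset.mul_sum, Matrix.mulVec, dotProduct, Finset.mul_sum]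
    refine Finset.sum_congr rfl fun j _ => ?_
    rw [h1]
    ring
  rw [h4, h3]
  ring

theorem trace_mul_self_eq_sum {D : Matrix (Fin d) (Fin d) ℂ} (hD : D.IsHermitian) :
    (D * D).trace = ((∑ j, ∑ k, ‖inEigenbasis hρ D j k‖ ^ 2 : ℝ) : ℂ) := by
  rw [trace_mul_eq_sum hρ]
  push_cast
  refine Finset.sum_congr rfl fun j _ => Finset.sum_congr rfl fun k _ => ?_
  rw [apply_mul_apply_of_isHermitian (inEigenbasis_isHermitian hρ hD)]
  push_cast; rfl

/-- The matrix elements of `D` between eigenvectors in the kernel of `ρ` vanish. -/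
def VanishesOnKernel (D : Matrix (Fin d) (Fin d) ℂ) : Prop :=
  ∀ j k, ¬ 0 < hρ.eigenvalues j + hρ.eigenvalues k → inEigenbasis hρ D j k = 0

theorem sldNormSq_le {c : ℝ} (D : Matrix (Fin d) (Fin d) ℂ) (hc : 0 < c)
    (h : ∀ j k, 0 < hρ.eigenvalues j + hρ.eigenvalues k →
      c ≤ hρ.eigenvalues j + hρ.eigenvalues k) :
    sldNormSq hρ D ≤ 2 / c * ∑ j, ∑ k, ‖inEigenbasis hρ D j k‖ ^ 2 := by
  rw [sldNormSq, Finset.mul_sum]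
  refine Finset.sum_le_sum fun j _ => ?_
  rw [Finset.mul_sum]
  refine Finset.sum_le_sum fun k _ => ?_
  split_ifs with hjk
  · rw [div_mul_eq_mul_div]
    exact div_le_div_of_nonneg_left (by positivity) hc (h j k hjk)
  · positivity

theorem sldNormSq_nonneg (D : Matrix (Fin d) (Fin d) ℂ) : 0 ≤ sldNormSq hρ D := by
  refine Finset.sum_nonneg fun j _ => Finset.sum_nonneg fun k _ => ?_
  split_ifs <;> positivity

theorem eq_zero_of_sldNormSq_eq_zero {D : Matrix (Fin d) (Fin d) ℂ}
    (hD : VanishesOnKernel hρ D) (h : sldNormSq hρ D = 0) : D = 0 := by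
  apply inEigenbasis_injective hρ
  ext j k
  have hn : ∀ j k, 0 ≤ (if 0 < hρ.eigenvalues j + hρ.eigenvalues k then
    2 * ‖inEigenbasis hρ D j k‖ ^ 2 / (hρ.eigenvalues j + hρ.eigenvalues k) else 0) := by
    intro j k
    split_ifs <;> positivity
  have h1 := (Finset.sum_eq_zero_iff_of_nonneg
    (fun j _ => Finset.sum_nonneg fun k _ => hn j k)).1 h j (Finset.mem_univ j)
  have h2 := (Finset.sum_eq_zero_iff_of_nonneg (fun k _ => hn j k)).1 h1 k (Finset.mem_univ k)
  have h0 : inEigenbasis hρ (0 : Matrix (Fin d) (Fin d) ℂ) = 0 := by simp [inEigenbasis]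
  rw [h0]
  by_cases hjk : 0 < hρ.eigenvalues j + hρ.eigenvalues k
  · rw [if_pos hjk] at h2
    have h3 : 2 * ‖inEigenbasis hρ D j k‖ ^ 2 = 0 := by
      rcases div_eq_zero_iff.1 h2 with h | h
      · exact h
      · exact absurd h hjk.ne'
    simpa using h3
  · simpa using hD j k hjk

/-- Cauchy–Schwarz inequality for the quantum Fisher information metric. -/
theorem sq_sum_le_sldNormSq_mul {D X : Matrix (Fin d) (Fin d) ℂ}
    (hD : VanishesOnKernel hρ D) {w : Fin d → Fin d → ℝ} (hw : ∀ j k, ‖X k j‖ ^ 2 ≤ w j k)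
    (h0 : ∀ j, 0 ≤ hρ.eigenvalues j) :
    (∑ j, ∑ k, inEigenbasis hρ D j k * X k j).re ^ 2 ≤ sldNormSq hρ D *
      ∑ j, ∑ k, (hρ.eigenvalues j + hρ.eigenvalues k) / 2 * w j k := by
  set lam := hρ.eigenvalues with hlam
  have h1 : |(∑ j, ∑ k, inEigenbasis hρ D j k * X k j).re| ≤
      ∑ x : Fin d × Fin d, ‖inEigenbasis hρ D x.1 x.2‖ * ‖X x.2 x.1‖ := by
    rw [Fintype.sum_prod_type]
    refine (Complex.abs_re_le_norm _).trans ((norm_sum_le _ _).trans ?_)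
    refine Finset.sum_le_sum fun j _ => (norm_sum_le _ _).trans ?_
    exact Finset.sum_le_sum fun k _ => (norm_mul _ _).le
  -- Cauchy–Schwarz with the weight (λ_j+λ_k)/2 and its inverse. Where the weight is zero, D itself
  -- vanishes, so nothing is lost.
  have h2 : (∑ x : Fin d × Fin d, ‖inEigenbasis hρ D x.1 x.2‖ * ‖X x.2 x.1‖) ^ 2 ≤
      (∑ x : Fin d × Fin d, if 0 < lam x.1 + lam x.2 then
        2 * ‖inEigenbasis hρ D x.1 x.2‖ ^ 2 / (lam x.1 + lam x.2) else 0) *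
      ∑ x : Fin d × Fin d, (lam x.1 + lam x.2) / 2 * ‖X x.2 x.1‖ ^ 2 := by
    apply Finset.sum_sq_le_sum_mul_sum_of_sq_le_mul
    · intro x _
      split_ifs <;> positivity
    · intro x _
      have := h0 x.1
      have := h0 x.2
      positivity
    · intro x _
      split_ifs with h
      · apply le_of_eq; field_simp
      · rw [hD _ _ h]; simp
  rw [Fintype.sum_prod_type (f := fun x : Fin d × Fin d => if 0 < lam x.1 + lam x.2 then
      2 * ‖inEigenbasis hρ D x.1 x.2‖ ^ 2 / (lam x.1 + lam x.2) else 0),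
    Fintype.sum_prod_type (f := fun x : Fin d × Fin d =>
      (lam x.1 + lam x.2) / 2 * ‖X x.2 x.1‖ ^ 2)] at h2
  refine (sq_le_sq' (neg_le_of_abs_le h1) (le_of_abs_le h1)).trans (h2.trans ?_)
  refine mul_le_mul_of_nonneg_left ?_ (sldNormSq_nonneg hρ D)
  refine Finset.sum_le_sum fun j _ => Finset.sum_le_sum fun k _ => ?_
  have := h0 j
  have := h0 k
  exact mul_le_mul_of_nonneg_left (hw j k) (by positivity)

/-! ### The information gained from a single measurement outcome -/

theorem norm_sq_apply_le {N : Matrix (Fin d) (Fin d) ℂ} (hN : N.PosSemidef) (j k : Fin d) :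
    ‖N j k‖ ^ 2 ≤ (N j j).re * (N k k).re := by
  have h := (hN.submatrix ![j, k]).det_nonneg
  rw [Matrix.det_fin_two] at h
  simp only [Matrix.submatrix_apply, Matrix.cons_val_zero, Matrix.cons_val_one] at h
  rw [apply_mul_apply_of_isHermitian hN.isHermitian] at h
  have h' := (Complex.le_def.1 h).1
  have hj := (Complex.le_def.1 (hN.diag_nonneg (i := j))).2
  simp only [Complex.zero_re, Complex.sub_re, Complex.mul_re, Complex.ofReal_re,
    Complex.zero_im] at h' hj
  rw [← hj] at h'
  linarith

theorem trace_state_mul_re (N : Matrix (Fin d) (Fin d) ℂ) :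
    (ρ * N).trace.re = ∑ j, hρ.eigenvalues j * (inEigenbasis hρ N j j).re := by
  rw [← trace_inEigenbasis hρ, inEigenbasis_mul, inEigenbasis_self]
  simp [Matrix.trace, Matrix.diagonal_mul]

/-- The weight of `N` on the eigenvectors in `S`. -/
noncomputable def traceOn (S : Fin d → Prop) [DecidablePred S] (N : Matrix (Fin d) (Fin d) ℂ) :
    ℝ :=
  ∑ j, if S j then (inEigenbasis hρ N j j).re else 0

theorem traceOn_nonneg (S : Fin d → Prop) [DecidablePred S] {N : Matrix (Fin d) (Fin d) ℂ}
    (hN : N.PosSemidef) : 0 ≤ traceOn hρ S N := by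
  refine Finset.sum_nonneg fun j _ => ?_
  split_ifs
  · exact (Complex.le_def.1 (inEigenbasis_posSemidef hρ hN).diag_nonneg).1
  · exact le_rfl

/-- Completeness of the POVM: every diagonal entry of the identity is 1. -/
theorem sum_traceOn (S : Fin d → Prop) [DecidablePred S] (M : POVM d) :
    ∑ x, traceOn hρ S (M.op x) = (Finset.univ.filter S).card := by
  have h : ∀ j, ∑ x, (inEigenbasis hρ (M.op x) j j).re = 1 := by
    intro j
    rw [← Complex.re_sum, ← Matrix.sum_apply, ← inEigenbasis_sum, M.sum_eq_one,
      inEigenbasis_one]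
    simp
  unfold traceOn
  rw [Finset.sum_comm]
  have : ∀ j, (∑ x, if S j then (inEigenbasis hρ (M.op x) j j).re else 0) =
      if S j then 1 else 0 := by
    intro j
    split_ifs
    · exact h j
    · simp
  simp [this]

/-- Derivatives on the span of the eigenvectors in `S`, which contains the support of `ρ`. -/
theorem sq_trace_le_of_block {S : Fin d → Prop} [DecidablePred S]
    {D N : Matrix (Fin d) (Fin d) ℂ} (hD : VanishesOnKernel hρ D) (htr : D.trace = 0)
    (hN : N.PosSemidef) (h0 : ∀ j, 0 ≤ hρ.eigenvalues j) (h1 : ∑ j, hρ.eigenvalues j = 1)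
    (hS : ∀ j, ¬ S j → hρ.eigenvalues j = 0)
    (hDS : ∀ j k, ¬ (S j ∧ S k) → inEigenbasis hρ D j k = 0) :
    (D * N).trace.re ^ 2 ≤ sldNormSq hρ D *
      ((ρ * N).trace.re * (traceOn hρ S N - (ρ * N).trace.re)) := by
  have hN' := inEigenbasis_posSemidef hρ hN
  have hp := trace_state_mul_re hρ N
  set p := (ρ * N).trace.re
  set lam := hρ.eigenvalues
  set n : Fin d → ℝ := fun j => (inEigenbasis hρ N j j).re with hn
  -- As Tr D = 0, the multiple p of the block identity can be subtracted from N. This produces the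
  -- -p in the bound; without it the sum over outcomes would be larger by 1, too much when m = r² -
  -- 1.
  let X : Matrix (Fin d) (Fin d) ℂ := fun k j =>
    if S j ∧ S k then inEigenbasis hρ N k j - (if k = j then (p : ℂ) else 0) else 0
  -- On the block: the 2×2 minor bound n_j n_k off the diagonal, the exact value (n_j - p)² on it.
  let w : Fin d → Fin d → ℝ := fun j k =>
    (if S j then n j else 0) * (if S k then n k else 0) -
      if j = k then (if S j then 2 * p * n j - p ^ 2 else 0) else 0
  have hw : ∀ j k, ‖X k j‖ ^ 2 ≤ w j k := by
    intro j k
    by_cases hjk : S j ∧ S k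
    · by_cases he : j = k
      · subst he
        simp only [X, w, hjk.1, and_self, if_true]
        have him : inEigenbasis hρ N j j = (n j : ℂ) := by
          have := hN'.isHermitian.coe_re_apply_self j
          simpa [hn] using this.symm
        rw [him, ← Complex.ofReal_sub, Complex.norm_real, Real.norm_eq_abs, sq_abs]
        apply le_of_eq; ring
      · simp only [X, w, hjk.1, hjk.2, and_self, if_true, he, Ne.symm he, if_false, sub_zero]
        rw [mul_comm]
        exact norm_sq_apply_le hN' k j
    · have hz : X k j = 0 := by simp only [X, hjk, if_false]
      rw [hz]
      by_cases hj : S j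
      · have hk : ¬ S k := fun h => hjk ⟨hj, h⟩
        have he : j ≠ k := fun h => hk (h ▸ hj)
        simp [w, hk, he]
      · simp [w, hj]
  have hmain := sq_sum_le_sldNormSq_mul hρ hD hw h0
  have e1 : (D * N).trace = ∑ j, ∑ k, inEigenbasis hρ D j k * X k j := by
    have hDt : ∑ j, inEigenbasis hρ D j j = 0 := by
      rw [← htr, ← trace_inEigenbasis hρ]; rfl
    have : ∀ j k, inEigenbasis hρ D j k * X k j =
        inEigenbasis hρ D j k * inEigenbasis hρ N k j -
          if k = j then p * inEigenbasis hρ D j j else 0 := by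
      intro j k
      by_cases hjk : S j ∧ S k
      · simp only [X, hjk, and_self, if_true]
        split_ifs with h
        · subst h; ring
        · ring
      · have hz := hDS j k hjk
        rw [hz]
        split_ifs with h
        · subst h; rw [hz]; simp
        · simp
    simp only [this, Finset.sum_sub_distrib, Finset.sum_ite_eq',
      Finset.mem_univ, if_true]
    rw [← Finset.mul_sum, hDt, mul_zero, sub_zero, trace_mul_eq_sum hρ]
  have e2 : ∑ j, ∑ k, (lam j + lam k) / 2 * w j k = p * (traceOn hρ S N - p) := by
    set s : Fin d → ℝ := fun j => if S j then n j else 0 with hs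
    have hls : ∀ j, lam j * s j = lam j * n j := by
      intro j
      by_cases hj : S j
      · simp [hs, hj]
      · simp [hS j hj]
    have hsum : ∑ j, s j = traceOn hρ S N := rfl
    have hexp : ∀ j k, (lam j + lam k) / 2 * w j k =
        1 / 2 * ((lam j * n j) * s k) + 1 / 2 * (s j * (lam k * n k)) -
          if j = k then lam j * (2 * p * n j - p ^ 2) else 0 := by
      intro j k
      rw [← hls j, ← hls k]
      change (lam j + lam k) / 2 * (s j * s k -
        if j = k then (if S j then 2 * p * n j - p ^ 2 else 0) else 0) = _
      split_ifs with h hj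
      · subst h; ring
      · subst h; rw [hS j hj]; ring
      · ring
    simp only [hexp, Finset.sum_sub_distrib, Finset.sum_add_distrib, Finset.sum_ite_eq,
      Finset.mem_univ, if_true, ← Finset.mul_sum, ← Finset.sum_mul]
    -- From ∑ λ_j n_j = p and ∑ λ_j = 1 the diagonal correction is 2p² - p².
    have h3 : ∑ j, lam j * (2 * p * n j - p ^ 2) = p ^ 2 := by
      have : ∀ j, lam j * (2 * p * n j - p ^ 2) = 2 * p * (lam j * n j) - p ^ 2 * lam j :=
        fun j => by ring
      simp only [this, Finset.sum_sub_distrib, ← Finset.mul_sum]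
      rw [h1, ← hp]; ring
    rw [h3, ← hp, hsum]
    ring
  rw [e1, ← e2]
  exact hmain

/-- Derivatives with matrix elements only between the support and the kernel of `ρ`. -/
theorem sq_trace_le_of_offDiagonal {D N : Matrix (Fin d) (Fin d) ℂ}
    (hD : VanishesOnKernel hρ D) (hN : N.PosSemidef) (h0 : ∀ j, 0 ≤ hρ.eigenvalues j)
    (hDS : ∀ j k, 0 < hρ.eigenvalues j → 0 < hρ.eigenvalues k → inEigenbasis hρ D j k = 0) :
    (D * N).trace.re ^ 2 ≤ sldNormSq hρ D *
      ((ρ * N).trace.re * traceOn hρ (fun j => ¬ 0 < hρ.eigenvalues j) N) := by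
  have hN' := inEigenbasis_posSemidef hρ hN
  have hp := trace_state_mul_re hρ N
  set p := (ρ * N).trace.re
  set lam := hρ.eigenvalues
  set n : Fin d → ℝ := fun j => (inEigenbasis hρ N j j).re with hn
  set s : Fin d → ℝ := fun j => if ¬ 0 < lam j then n j else 0 with hs
  have hz : ∀ j, ¬ 0 < lam j → lam j = 0 := fun j hj => le_antisymm (not_lt.1 hj) (h0 j)
  -- D sees only the blocks of N between support and kernel, so the other two are deleted. A
  -- surviving entry is bounded by one diagonal entry on the support times one on the kernel.
  let X : Matrix (Fin d) (Fin d) ℂ := fun k j =>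
    if 0 < lam j ∧ 0 < lam k ∨ ¬ 0 < lam j ∧ ¬ 0 < lam k then 0 else inEigenbasis hρ N k j
  let w : Fin d → Fin d → ℝ := fun j k => (n j - s j) * s k + s j * (n k - s k)
  have hw : ∀ j k, ‖X k j‖ ^ 2 ≤ w j k := by
    intro j k
    have := norm_sq_apply_le hN' k j
    have hs1 : ∀ i, 0 < lam i → s i = 0 := fun i hi => if_neg (not_not.2 hi)
    have hs2 : ∀ i, ¬ 0 < lam i → s i = n i := fun i hi => if_pos hi
    simp only [X, w]
    by_cases hj : 0 < lam j <;> by_cases hk : 0 < lam k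
    · rw [if_pos (Or.inl ⟨hj, hk⟩), hs1 j hj, hs1 k hk]; simp
    · rw [if_neg (by tauto), hs1 j hj, hs2 k hk]; simp only [hn]; linarith
    · rw [if_neg (by tauto), hs2 j hj, hs1 k hk]; simp only [hn]; linarith
    · rw [if_pos (Or.inr ⟨hj, hk⟩), hs2 j hj, hs2 k hk]; simp
  have hmain := sq_sum_le_sldNormSq_mul hρ hD hw h0
  have e1 : (D * N).trace = ∑ j, ∑ k, inEigenbasis hρ D j k * X k j := by
    rw [trace_mul_eq_sum hρ]
    refine Finset.sum_congr rfl fun j _ => Finset.sum_congr rfl fun k _ => ?_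
    simp only [X]
    split_ifs with h
    · rcases h with h | h
      · rw [hDS j k h.1 h.2]; simp
      · have : ¬ 0 < lam j + lam k := by rw [hz j h.1, hz k h.2]; simp
        rw [hD j k this]; simp
    · rfl
  have e2 : ∑ j, ∑ k, (lam j + lam k) / 2 * w j k =
      p * traceOn hρ (fun j => ¬ 0 < lam j) N := by
    have hls : ∀ j, lam j * s j = 0 := by
      intro j
      by_cases hj : 0 < lam j
      · simp [hs, hj]
      · simp [hz j hj]
    have hsum : ∑ j, s j = traceOn hρ (fun j => ¬ 0 < lam j) N := rfl
    have hexp : ∀ j k, (lam j + lam k) / 2 * w j k =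
        1 / 2 * ((lam j * n j) * s k) + 1 / 2 * (s j * (lam k * n k)) := by
      intro j k
      simp only [w]
      linear_combination (-s k + n k / 2) * hls j + (- s j + n j / 2) * hls k
    simp only [hexp, Finset.sum_add_distrib, ← Finset.mul_sum, ← Finset.sum_mul]
    rw [← hp, hsum]
    ring
  rw [e1, ← e2]
  exact hmain

end Eigenbasis

open scoped MatrixOrder in
-- With Q = b*b the trace equals Tr(b P b*).
theorem trace_mul_nonneg {𝕜 n : Type*} [RCLike 𝕜] [Fintype n] {P Q : Matrix n n 𝕜}
    (hP : P.PosSemidef) (hQ : Q.PosSemidef) : 0 ≤ (P * Q).trace := by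
  classical
  obtain ⟨b, rfl⟩ := CStarAlgebra.nonneg_iff_eq_star_mul_self.mp hQ.nonneg
  rw [← Matrix.mul_assoc, Matrix.trace_mul_comm, ← Matrix.mul_assoc]
  exact (hP.mul_mul_conjTranspose_same b).trace_nonneg

theorem re_trace_mul_nonneg {d : ℕ} {P Q : Matrix (Fin d) (Fin d) ℂ} (hP : P.PosSemidef)
    (hQ : Q.PosSemidef) : 0 ≤ (P * Q).trace.re :=
  (Complex.le_def.1 (trace_mul_nonneg hP hQ)).1

/-! ### Fisher information of `3`-designs -/

section Design

variable {d : ℕ}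

namespace IsDensity

variable {ρ : Matrix (Fin d) (Fin d) ℂ}

theorem neZero (h : IsDensity ρ) : NeZero d := by
  constructor
  rintro rfl
  have := h.trace_eq_one
  simp at this

theorem eigenvalues_nonneg (h : IsDensity ρ) (j : Fin d) : 0 ≤ h.posSemidef.isHermitian.eigenvalues j :=
  h.posSemidef.eigenvalues_nonneg j

theorem sum_eigenvalues (h : IsDensity ρ) : ∑ j, h.posSemidef.isHermitian.eigenvalues j = 1 := by
  have := h.posSemidef.isHermitian.trace_eq_sum_eigenvalues
  rw [h.trace_eq_one] at this
  apply Complex.ofReal_injective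
  rw [Complex.ofReal_sum]
  exact this.symm

theorem eigenvalues_le_one (h : IsDensity ρ) (j : Fin d) : h.posSemidef.isHermitian.eigenvalues j ≤ 1 := by
  rw [← h.sum_eigenvalues]
  exact Finset.single_le_sum (fun i _ => h.eigenvalues_nonneg i) (Finset.mem_univ j)

theorem re_trace_mul_le (h : IsDensity ρ) {N : Matrix (Fin d) (Fin d) ℂ} (hN : N.PosSemidef) :
    (ρ * N).trace.re ≤ N.trace.re := by
  have hρ := h.posSemidef.isHermitian
  rw [trace_state_mul_re hρ, ← trace_inEigenbasis hρ N, Matrix.trace, Complex.re_sum]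
  refine Finset.sum_le_sum fun j _ => ?_
  exact mul_le_of_le_one_left
    (Complex.le_def.1 (inEigenbasis_posSemidef hρ hN).diag_nonneg).1 (h.eigenvalues_le_one j)

end IsDensity

theorem ofReal_re_expect {A : Matrix (Fin d) (Fin d) ℂ} (hA : A.IsHermitian)
    (v : EuclideanSpace ℂ (Fin d)) : ((expect A v).re : ℂ) = expect A v := by
  apply Complex.conj_eq_iff_re.1
  change star (A * ketbra v).trace = (A * ketbra v).trace
  have hk : (ketbra v)ᴴ = ketbra v := by
    ext a b
    simp [ketbra, mul_comm]
  rw [← Matrix.trace_conjTranspose, Matrix.conjTranspose_mul, hk, hA.eq, Matrix.trace_mul_comm]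

/-- The tangent bound 1/ε ≥ 2τ - τ²ε replaces the quotient by moments of degree at most 3. By `hker`
the outcomes of probability zero, absent from the right side, have vanishing derivative and cost
nothing. -/
theorem POVM.IsThreeDesign.le_sum_sq_div {M : POVM d} (hM : M.IsThreeDesign)
    {ρ D : Matrix (Fin d) (Fin d) ℂ} (hρ : IsDensity ρ) (hD : D.IsHermitian) (htr : D.trace = 0)
    (hker : ∀ N : Matrix (Fin d) (Fin d) ℂ, N.PosSemidef → (ρ * N).trace.re = 0 →
      (D * N).trace.re = 0) :
    (1 / 3) * (D * D).trace.re ≤ ∑ x, if (ρ * M.op x).trace.re ≠ 0 then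
      1 / (ρ * M.op x).trace.re * (D * M.op x).trace.re ^ 2 else 0 := by
  have := hρ.neZero
  obtain ⟨q, v, hq, hv, hop, hdes⟩ := hM
  obtain ⟨c, hc, hmean⟩ := exists_haarMean_expect d
  have hd : (0 : ℝ) < d := by exact_mod_cast Nat.pos_of_ne_zero (NeZero.ne d)
  have hDD : (D * D).PosSemidef := by
    nth_rw 1 [← hD.eq]
    exact posSemidef_conjTranspose_mul_self D
  set T := (D * D).trace.re with hT
  have hTc : (D * D).trace = (T : ℂ) := by
    apply Complex.ext
    · simp [hT]
    · simpa using (Complex.le_def.1 hDD.trace_nonneg).2.symm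
  have hT0 : 0 ≤ T := (Complex.le_def.1 hDD.trace_nonneg).1
  set C : ℝ := 1 / (d * (d + 1) * (d + 2)) with hC
  have hcC : c = (C : ℂ) := by
    have h0 : ((d * (d + 1) * (d + 2) : ℝ) : ℂ) ≠ 0 := by
      exact_mod_cast (by positivity : (d * (d + 1) * (d + 2) : ℝ) ≠ 0)
    have h1 : (C : ℂ) * ((d * (d + 1) * (d + 2) : ℝ) : ℂ) = 1 := by
      rw [← Complex.ofReal_mul, hC, one_div_mul_cancel (by positivity)]; simp
    apply mul_right_cancel₀ h0
    rw [h1, ← hc]; push_cast; ring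
  have hC0 : 0 ≤ C := by positivity
  set e : Fin M.n → ℝ := fun s => (expect D (v s)).re with he
  set ε : Fin M.n → ℝ := fun s => (expect ρ (v s)).re with hε
  have htrace : ∀ (A : Matrix (Fin d) (Fin d) ℂ) s,
      (A * M.op s).trace.re = q s * d * (expect A (v s)).re := by
    intro A s
    rw [hop, Matrix.mul_smul, Matrix.trace_smul, smul_eq_mul, Complex.re_ofReal_mul]
    rfl
  -- The moment formula with B = 1, which is ⟨B⟩ = 1 on unit vectors.
  have h2 : ∑ s, q s * e s ^ 2 = C * (d + 2) * T := by
    have := hdes.sum_expect D D 1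
    rw [hmean D 1 hD htr, hcC, Matrix.mul_one, hTc, Matrix.trace_one, Fintype.card_fin] at this
    have h' : ((∑ s, q s * e s ^ 2 : ℝ) : ℂ) = ((C * (d + 2) * T : ℝ) : ℂ) := by
      push_cast
      rw [show (C : ℂ) * (d + 2) * T = C * (T * d + 2 * T) by ring, ← this]
      refine Finset.sum_congr rfl fun s _ => ?_
      rw [expect_one, hv, ← ofReal_re_expect hD]
      change (q s : ℂ) * ((expect D (v s)).re : ℂ) ^ 2 = _
      push_cast; ring
    exact_mod_cast h'
  -- The moment formula with B = ρ; the 3 is 1 + 2, using Tr(ρD²) ≤ Tr D².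
  have h3 : ∑ s, q s * (e s ^ 2 * ε s) ≤ 3 * C * T := by
    have := hdes.sum_expect D D ρ
    rw [hmean D ρ hD htr, hcC, hTc, hρ.trace_eq_one, mul_one] at this
    have h' := congrArg Complex.re this
    rw [Complex.re_ofReal_mul, Complex.re_sum] at h'
    have h4 : ∑ s, q s * (e s ^ 2 * ε s) = C * (T + 2 * (ρ * (D * D)).trace.re) := by
      rw [Matrix.trace_mul_comm ρ]
      have e5 : ((T : ℂ) + 2 * (D * D * ρ).trace).re = T + 2 * (D * D * ρ).trace.re := by simp
      rw [← e5, ← h']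
      refine Finset.sum_congr rfl fun s _ => ?_
      rw [Complex.re_ofReal_mul, ← ofReal_re_expect hD,
        ← ofReal_re_expect hρ.posSemidef.isHermitian, ← Complex.ofReal_mul, ← Complex.ofReal_mul,
        Complex.ofReal_re]
      ring
    rw [h4]
    have := hρ.re_trace_mul_le hDD
    nlinarith
  -- The maximizer of 2τA - τ²B for A = C(d+2)T and B = 3CT is A/B.
  set τ : ℝ := (d + 2) / 3 with hτ
  have hterm : ∀ s, 2 * τ * d * (q s * e s ^ 2) - τ ^ 2 * d * (q s * (e s ^ 2 * ε s)) ≤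
      if (ρ * M.op s).trace.re ≠ 0 then
        1 / (ρ * M.op s).trace.re * (D * M.op s).trace.re ^ 2 else 0 := by
    intro s
    have hp := re_trace_mul_nonneg hρ.posSemidef (M.posSemidef s)
    have hs := hq s
    split_ifs with h
    · rw [htrace] at hp h
      rw [htrace, htrace]
      change 0 ≤ q s * d * ε s at hp
      change q s * d * ε s ≠ 0 at h
      change _ ≤ 1 / (q s * d * ε s) * (q s * d * e s) ^ 2
      have hε0 : 0 < ε s := pos_of_mul_pos_right (lt_of_le_of_ne hp h.symm) (by positivity)
      -- The gap in the tangent inequality is a perfect square over ε.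
      have : 1 / (q s * d * ε s) * (q s * d * e s) ^ 2 -
          (2 * τ * d * (q s * e s ^ 2) - τ ^ 2 * d * (q s * (e s ^ 2 * ε s))) =
          q s * d * e s ^ 2 * (1 - τ * ε s) ^ 2 / ε s := by
        field_simp
        ring
      have h5 : 0 ≤ q s * d * e s ^ 2 * (1 - τ * ε s) ^ 2 / ε s := by positivity
      linarith
    · have h6 := hker _ (M.posSemidef s) (not_not.1 h)
      rw [htrace] at h6
      have : e s = 0 := by
        rcases mul_eq_zero.1 h6 with h7 | h7
        · exact absurd h7 (by positivity)
        · exact h7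
      rw [this]; simp
  refine le_trans ?_ (Finset.sum_le_sum fun s _ => hterm s)
  rw [Finset.sum_sub_distrib, ← Finset.mul_sum, ← Finset.mul_sum, h2]
  have h8 : τ ^ 2 * d * ∑ s, q s * (e s ^ 2 * ε s) ≤ τ ^ 2 * d * (3 * C * T) :=
    mul_le_mul_of_nonneg_left h3 (by positivity)
  have h9 : 2 * τ * d * (C * (d + 2) * T) - τ ^ 2 * d * (3 * C * T) =
      (1 / 3) * T * ((d + 2) / (d + 1)) := by
    rw [hC, hτ]; field_simp; ring
  have h10 : (1 : ℝ) ≤ (d + 2) / (d + 1) := by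
    rw [le_div_iff₀ (by positivity)]; linarith
  have h11 : (1 / 3) * T ≤ (1 / 3) * T * ((d + 2) / (d + 1)) :=
    le_mul_of_one_le_right (by positivity) h10
  linarith

end Design

/-! ### Derivatives of a parameterized state -/

namespace ParamState

variable (S : ParamState)

theorem hasDerivAt_entry (i : Fin S.m) (a b : Fin S.d) :
    HasDerivAt (fun t : ℝ => S.ρ (S.θ + t • Pi.single i 1) a b) (S.pderiv i a b) 0 :=
  (S.differentiable i a b).hasLineDerivAt

theorem eventually_isDensity (i : Fin S.m) :
    ∀ᶠ t : ℝ in 𝓝 0, IsDensity (S.ρ (S.θ + t • Pi.single i 1)) := by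
  have hc : Continuous fun t : ℝ => S.θ + t • (Pi.single i 1 : Fin S.m → ℝ) := by fun_prop
  have := hc.tendsto 0
  simp only [zero_smul, add_zero] at this
  exact this.eventually S.isDensity

theorem hasDerivAt_trace_mul (i : Fin S.m) (N : Matrix (Fin S.d) (Fin S.d) ℂ) :
    HasDerivAt (fun t : ℝ => (S.ρ (S.θ + t • Pi.single i 1) * N).trace)
      (S.pderiv i * N).trace 0 := by
  simp only [Matrix.trace, Matrix.diag_apply, Matrix.mul_apply]
  exact HasDerivAt.fun_sum fun a _ => HasDerivAt.fun_sum fun b _ =>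
    (S.hasDerivAt_entry i a b).mul_const _

theorem hasDerivAt_re_trace_mul (i : Fin S.m) (N : Matrix (Fin S.d) (Fin S.d) ℂ) :
    HasDerivAt (fun t : ℝ => (S.ρ (S.θ + t • Pi.single i 1) * N).trace.re)
      (S.pderiv i * N).trace.re 0 :=
  Complex.reCLM.hasFDerivAt.comp_hasDerivAt (0 : ℝ) (S.hasDerivAt_trace_mul i N)

theorem probDeriv_eq (M : POVM S.d) (x : Fin M.n) (i : Fin S.m) :
    S.probDeriv M x i = (S.pderiv i * M.op x).trace.re :=
  HasLineDerivAt.lineDeriv (S.hasDerivAt_re_trace_mul i (M.op x))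

theorem pderiv_isHermitian (i : Fin S.m) : (S.pderiv i).IsHermitian := by
  ext a b
  rw [Matrix.conjTranspose_apply]
  have h1 := (S.hasDerivAt_entry i b a).star
  have h2 := S.hasDerivAt_entry i a b
  refine h1.unique (h2.congr_of_eventuallyEq ?_)
  filter_upwards [S.eventually_isDensity i] with t ht
  exact ht.posSemidef.isHermitian.apply a b

theorem trace_pderiv (i : Fin S.m) : (S.pderiv i).trace = 0 := by
  have h1 := S.hasDerivAt_trace_mul i 1
  simp only [Matrix.mul_one] at h1
  refine h1.unique ((hasDerivAt_const (0 : ℝ) (1 : ℂ)).congr_of_eventuallyEq ?_)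
  filter_upwards [S.eventually_isDensity i] with t ht
  exact ht.trace_eq_one

/-- Nearby states give nonnegative values, so a zero at the local point is a local minimum. -/
theorem re_trace_pderiv_mul_eq_zero (i : Fin S.m) {N : Matrix (Fin S.d) (Fin S.d) ℂ}
    (hN : N.PosSemidef) (h : (S.state * N).trace.re = 0) : (S.pderiv i * N).trace.re = 0 := by
  refine IsLocalMin.hasDerivAt_eq_zero ?_ (S.hasDerivAt_re_trace_mul i N)
  filter_upwards [S.eventually_isDensity i] with t ht
  have h0 : (S.ρ (S.θ + (0 : ℝ) • Pi.single i 1) * N).trace.re = 0 := by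
    simpa [state] using h
  rw [h0]
  exact re_trace_mul_nonneg ht.posSemidef hN

/-- The derivative of the state in the direction `a`. -/
noncomputable def dirDeriv (a : Fin S.m → ℝ) : Matrix (Fin S.d) (Fin S.d) ℂ :=
  ∑ i, a i • S.pderiv i

theorem dirDeriv_isHermitian (a : Fin S.m → ℝ) : (S.dirDeriv a).IsHermitian := by
  unfold Matrix.IsHermitian dirDeriv
  rw [Matrix.conjTranspose_sum]
  refine Finset.sum_congr rfl fun i _ => ?_
  rw [Matrix.conjTranspose_smul, (S.pderiv_isHermitian i).eq]; simp

theorem trace_dirDeriv (a : Fin S.m → ℝ) : (S.dirDeriv a).trace = 0 := by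
  simp [dirDeriv, Matrix.trace_sum, trace_pderiv]

theorem re_trace_dirDeriv_mul (a : Fin S.m → ℝ) (N : Matrix (Fin S.d) (Fin S.d) ℂ) :
    (S.dirDeriv a * N).trace.re = ∑ i, a i * (S.pderiv i * N).trace.re := by
  simp [dirDeriv, Matrix.sum_mul, Matrix.trace_sum]

theorem re_trace_dirDeriv_mul_eq_zero (a : Fin S.m → ℝ) {N : Matrix (Fin S.d) (Fin S.d) ℂ}
    (hN : N.PosSemidef) (h : (S.state * N).trace.re = 0) : (S.dirDeriv a * N).trace.re = 0 := by
  rw [re_trace_dirDeriv_mul]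
  exact Finset.sum_eq_zero fun i _ => by rw [S.re_trace_pderiv_mul_eq_zero i hN h, mul_zero]

theorem inEigenbasis_dirDeriv_eq_zero (a : Fin S.m → ℝ) {j k : Fin S.d}
    (h : ∀ i, inEigenbasis S.state_isHermitian (S.pderiv i) j k = 0) :
    inEigenbasis S.state_isHermitian (S.dirDeriv a) j k = 0 := by
  rw [dirDeriv, inEigenbasis_sum, Matrix.sum_apply]
  exact Finset.sum_eq_zero fun i _ => by
    rw [inEigenbasis_smul, Matrix.smul_apply, h i, smul_zero]

theorem eigenvalues_nonneg (j : Fin S.d) : 0 ≤ S.state_isHermitian.eigenvalues j :=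
  S.state_isDensity.eigenvalues_nonneg j

/-- A rank-one N supported in the kernel has probability zero, hence derivative zero: the quadratic
form of D vanishes on the kernel. -/
theorem dirDeriv_vanishesOnKernel (a : Fin S.m → ℝ) :
    VanishesOnKernel S.state_isHermitian (S.dirDeriv a) := by
  set lam := S.state_isHermitian.eigenvalues with hlam
  set D' := inEigenbasis S.state_isHermitian (S.dirDeriv a) with hD'
  have hD'h : D'.IsHermitian := inEigenbasis_isHermitian _ (S.dirDeriv_isHermitian a)
  have hvec : ∀ x : Fin S.d → ℂ, (∀ j, lam j ≠ 0 → x j = 0) →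
      (star x ⬝ᵥ (D' *ᵥ x)).re = 0 := by
    intro x hx
    let U := (S.state_isHermitian.eigenvectorUnitary : Matrix (Fin S.d) (Fin S.d) ℂ)
    have hN : (U * vecMulVec x (star x) * Uᴴ).PosSemidef :=
      (posSemidef_vecMulVec_self_star x).mul_mul_conjTranspose_same U
    have hNe : inEigenbasis S.state_isHermitian (U * vecMulVec x (star x) * Uᴴ) =
      vecMulVec x (star x) := inEigenbasis_conj _ _
    have h1 := S.re_trace_dirDeriv_mul_eq_zero a hN (by
      rw [trace_state_mul_re S.state_isHermitian, hNe]
      refine Finset.sum_eq_zero fun j _ => ?_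
      rw [← hlam]
      by_cases hj : lam j = 0
      · rw [hj, zero_mul]
      · simp [vecMulVec_apply, hx j hj])
    rw [← trace_inEigenbasis S.state_isHermitian, inEigenbasis_mul, hNe, ← hD',
      Matrix.mul_vecMulVec, Matrix.trace_vecMulVec, dotProduct_comm] at h1
    exact h1
  set P : Matrix (Fin S.d) (Fin S.d) ℂ := diagonal fun j => if lam j = 0 then 1 else 0 with hP
  have hPs : Pᴴ = P := by
    rw [hP, Matrix.diagonal_conjTranspose]
    congr 1
    ext j
    simp only [Pi.star_apply]
    split_ifs <;> simp
  set E := Pᴴ * D' * P with hE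
  have hEh : E.IsHermitian := isHermitian_conjTranspose_mul_mul _ hD'h
  have hEvec : ∀ x, (star x ⬝ᵥ (E *ᵥ x)).re = 0 := by
    intro x
    have := hvec (P *ᵥ x) (fun j hj => by simp [hP, mulVec_diagonal, hj])
    rw [hE, ← Matrix.mulVec_mulVec, ← Matrix.mulVec_mulVec, dotProduct_mulVec,
      ← Matrix.star_mulVec]
    exact this
  -- A vanishing quadratic form is in particular nonnegative, so the 2×2 minor bound applies, and
  -- the zero diagonal then kills every entry.
  have hEpos : E.PosSemidef := by
    refine PosSemidef.of_dotProduct_mulVec_nonneg hEh fun x => ?_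
    rw [Complex.le_def]
    refine ⟨(hEvec x).ge, ?_⟩
    have := hEh.im_star_dotProduct_mulVec_self x
    simpa using this.symm
  intro j k hjk
  have hj : lam j = 0 := by
    have := S.eigenvalues_nonneg j; have := S.eigenvalues_nonneg k; linarith
  have hk : lam k = 0 := by
    have := S.eigenvalues_nonneg j; have := S.eigenvalues_nonneg k; linarith
  have hEjk : E j k = D' j k := by
    rw [hE, hPs, hP, Matrix.mul_diagonal, Matrix.diagonal_mul]
    simp [hj, hk]
  have hEkk : (E k k).re = 0 := by
    have := hEvec (Pi.single k 1)
    simpa [Matrix.mulVec_single, dotProduct_comm, ← Pi.single_star] using this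
  have := norm_sq_apply_le hEpos j k
  rw [hEkk, mul_zero, hEjk] at this
  have h0 : ‖D' j k‖ = 0 := by
    have := sq_nonneg ‖D' j k‖
    exact pow_eq_zero_iff (two_ne_zero) |>.1 (le_antisymm ‹_› this)
  exact norm_eq_zero.1 h0

end ParamState

/-! ### Trace inequalities for real matrices -/

section RealMatrices

variable {m : ℕ} {A J : Matrix (Fin m) (Fin m) ℝ}

/-- Pair A - cJ ⪰ 0 with A⁻¹. -/
theorem trace_mul_inv_le (hA : A.PosDef) {c : ℝ} (hc : 0 < c)
    (h : (A - c • J).PosSemidef) : (J * A⁻¹).trace ≤ m / c := by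
  have h1 := trace_mul_nonneg h hA.inv.posSemidef
  rw [Matrix.sub_mul, Matrix.trace_sub, Matrix.mul_nonsing_inv _ ((isUnit_iff_isUnit_det _).1
    hA.isUnit), Matrix.trace_one, Fintype.card_fin, Matrix.smul_mul, Matrix.trace_smul,
    smul_eq_mul] at h1
  rw [le_div_iff₀ hc]
  linarith

/-- With X = A⁻¹ - tJ⁻¹, expanding Tr(XJXA) ≥ 0 gives Tr(JA⁻¹) ≥ 2tm - t² Tr(J⁻¹A), a Cauchy–Schwarz
inequality without division. -/
theorem mul_le_trace_mul_inv (hA : A.PosDef) (hJ : J.PosDef) (t : ℝ)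
    (h : t * (J⁻¹ * A).trace ≤ m) (ht : 0 ≤ t) : t * m ≤ (J * A⁻¹).trace := by
  have uA := (isUnit_iff_isUnit_det _).1 hA.isUnit
  have uJ := (isUnit_iff_isUnit_det _).1 hJ.isUnit
  set X := A⁻¹ - t • J⁻¹ with hX
  have hXh : Xᴴ = X := by
    rw [hX, Matrix.conjTranspose_sub, Matrix.conjTranspose_smul, hA.inv.isHermitian.eq,
      hJ.inv.isHermitian.eq]
    simp
  have h1 : (X * J * X).PosSemidef := by
    have := hJ.posSemidef.conjTranspose_mul_mul_same X
    rwa [hXh] at this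
  have h2 := trace_mul_nonneg h1 hA.posSemidef
  have h3 : X * A = 1 - t • (J⁻¹ * A) := by
    rw [hX, Matrix.sub_mul, Matrix.nonsing_inv_mul _ uA, Matrix.smul_mul]
  have h4 : X * J = A⁻¹ * J - t • 1 := by
    rw [hX, Matrix.sub_mul, Matrix.smul_mul, Matrix.nonsing_inv_mul _ uJ]
  have h5 : A⁻¹ * J * (J⁻¹ * A) = 1 := by
    rw [Matrix.mul_assoc, ← Matrix.mul_assoc J, Matrix.mul_nonsing_inv _ uJ, Matrix.one_mul,
      Matrix.nonsing_inv_mul _ uA]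
  rw [Matrix.mul_assoc (X * J), h3, h4, Matrix.mul_sub, Matrix.mul_one, Matrix.mul_smul,
    Matrix.sub_mul, h5, Matrix.trace_sub, Matrix.trace_sub, Matrix.trace_smul, Matrix.trace_smul,
    Matrix.trace_sub, Matrix.smul_mul, Matrix.one_mul, Matrix.trace_smul, Matrix.trace_one,
    Fintype.card_fin, Matrix.trace_mul_comm] at h2
  simp only [smul_eq_mul] at h2
  nlinarith [mul_le_mul_of_nonneg_left h ht]

/-- The left side is the squared dual norm of g; the extremal test vector is a = J⁻¹g. -/
theorem dotProduct_inv_mulVec_le (hJ : J.PosDef) {g : Fin m → ℝ} {K : ℝ} (hK : 0 ≤ K)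
    (h : ∀ a : Fin m → ℝ, (a ⬝ᵥ g) ^ 2 ≤ a ⬝ᵥ (J *ᵥ a) * K) : g ⬝ᵥ (J⁻¹ *ᵥ g) ≤ K := by
  have uJ := (isUnit_iff_isUnit_det _).1 hJ.isUnit
  have h1 := h (J⁻¹ *ᵥ g)
  rw [Matrix.mulVec_mulVec, Matrix.mul_nonsing_inv _ uJ, Matrix.one_mulVec,
    dotProduct_comm] at h1
  by_cases hg : g = 0
  · simpa [hg] using hK
  · have h3 : 0 < g ⬝ᵥ (J⁻¹ *ᵥ g) := hJ.inv.dotProduct_mulVec_pos hg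
    nlinarith

end RealMatrices

namespace ParamState

variable (S : ParamState)

/-! ### Fisher information matrices of a parameterized state -/

theorem isHermitian_qfim : S.qfim.IsHermitian := by
  rw [Matrix.IsHermitian, Matrix.conjTranspose_eq_transpose_of_trivial]
  exact qfimOf_transpose _ _

theorem dotProduct_qfim_mulVec (a : Fin S.m → ℝ) :
    a ⬝ᵥ (S.qfim *ᵥ a) = sldNormSq S.state_isHermitian (S.dirDeriv a) :=
  dotProduct_qfimOf_mulVec _ S.pderiv_isHermitian a

theorem qfim_posDef (h : S.IsIdentifiable) : S.qfim.PosDef := by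
  refine PosDef.of_dotProduct_mulVec_pos S.isHermitian_qfim fun {a} ha => ?_
  rw [star_trivial, dotProduct_qfim_mulVec]
  refine lt_of_le_of_ne (sldNormSq_nonneg _ _) fun h0 => ha ?_
  have := eq_zero_of_sldNormSq_eq_zero _ (S.dirDeriv_vanishesOnKernel a) h0.symm
  exact funext (Fintype.linearIndependent_iff.1 h a this)

/-- The reciprocal of the outcome probability, or `0` if the outcome does not occur. -/
noncomputable def invProb (M : POVM S.d) (x : Fin M.n) : ℝ :=
  if S.prob M x S.θ ≠ 0 then 1 / S.prob M x S.θ else 0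

theorem prob_nonneg (M : POVM S.d) (x : Fin M.n) : 0 ≤ S.prob M x S.θ :=
  re_trace_mul_nonneg S.state_isDensity.posSemidef (M.posSemidef x)

theorem sum_prob (M : POVM S.d) : ∑ x, S.prob M x S.θ = 1 := by
  change ∑ x, (S.state * M.op x).trace.re = 1
  rw [← Complex.re_sum, ← Matrix.trace_sum, ← Matrix.mul_sum, M.sum_eq_one, Matrix.mul_one,
    S.state_isDensity.trace_eq_one, Complex.one_re]

theorem invProb_nonneg (M : POVM S.d) (x : Fin M.n) : 0 ≤ S.invProb M x := by
  have := S.prob_nonneg M x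
  unfold invProb
  split_ifs <;> positivity

theorem cfim_eq_sum (M : POVM S.d) : S.cfim M =
    ∑ x, S.invProb M x • vecMulVec (S.probDeriv M x) (S.probDeriv M x) := by
  ext i j
  rw [Matrix.sum_apply, cfim, Matrix.of_apply]
  refine Finset.sum_congr rfl fun x _ => ?_
  simp only [Matrix.smul_apply, vecMulVec_apply, invProb, smul_eq_mul]
  split_ifs <;> ring

theorem isHermitian_cfim (M : POVM S.d) : (S.cfim M).IsHermitian := by
  rw [cfim_eq_sum, Matrix.IsHermitian, Matrix.conjTranspose_sum]
  refine Finset.sum_congr rfl fun x _ => ?_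
  rw [Matrix.conjTranspose_smul, Matrix.conjTranspose_vecMulVec, star_trivial, star_trivial]

theorem dotProduct_probDeriv (M : POVM S.d) (x : Fin M.n) (a : Fin S.m → ℝ) :
    a ⬝ᵥ S.probDeriv M x = (S.dirDeriv a * M.op x).trace.re := by
  rw [re_trace_dirDeriv_mul]
  simp only [dotProduct, probDeriv_eq]

theorem dotProduct_cfim_mulVec (M : POVM S.d) (a : Fin S.m → ℝ) :
    a ⬝ᵥ (S.cfim M *ᵥ a) = ∑ x, if (S.state * M.op x).trace.re ≠ 0 then
      1 / (S.state * M.op x).trace.re * (S.dirDeriv a * M.op x).trace.re ^ 2 else 0 := by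
  rw [cfim_eq_sum, Matrix.sum_mulVec, dotProduct_sum]
  refine Finset.sum_congr rfl fun x _ => ?_
  rw [Matrix.smul_mulVec, dotProduct_smul, Matrix.vecMulVec_mulVec, ← dotProduct_probDeriv,
    smul_eq_mul]
  change S.invProb M x * _ = if S.prob M x S.θ ≠ 0 then _ else _
  unfold invProb
  rw [dotProduct_comm _ a]
  simp only [op_smul_eq_smul, dotProduct_smul, smul_eq_mul]
  split_ifs
  · change _ = 1 / S.prob M x S.θ * _
    ring
  · simp

/-- I(M) is a sum of rank-one matrices g_x g_xᵀ/p_x, so the trace is the sum of the squared dual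
norms of g_x divided by p_x. The hypothesis bounds each squared dual norm by p_x β_x. -/
theorem trace_inv_mul_cfim_le (hJ : S.qfim.PosDef) (M : POVM S.d) {β : Fin M.n → ℝ}
    (hβ : ∀ x, 0 ≤ β x)
    (h : ∀ x a, (S.dirDeriv a * M.op x).trace.re ^ 2 ≤
      sldNormSq S.state_isHermitian (S.dirDeriv a) * (S.prob M x S.θ * β x)) :
    (S.qfim⁻¹ * S.cfim M).trace ≤ ∑ x, β x := by
  rw [cfim_eq_sum, Matrix.mul_sum, Matrix.trace_sum]
  refine Finset.sum_le_sum fun x _ => ?_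
  have hp := S.prob_nonneg M x
  rw [Matrix.mul_smul, Matrix.trace_smul, smul_eq_mul, Matrix.mul_vecMulVec,
    Matrix.trace_vecMulVec, dotProduct_comm]
  have h1 := dotProduct_inv_mulVec_le hJ (g := S.probDeriv M x) (mul_nonneg hp (hβ x)) fun a => by
    rw [dotProduct_probDeriv, dotProduct_qfim_mulVec]
    exact h x a
  refine (mul_le_mul_of_nonneg_left h1 (S.invProb_nonneg M x)).trans ?_
  unfold invProb
  split_ifs with h0
  · apply le_of_eq; field_simp
  · simpa using hβ x

/-! ### Rank, conditioning and the two-sided comparison with J -/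

theorem rank_eq_card :
    S.rank = (Finset.univ.filter fun j => 0 < S.state_isHermitian.eigenvalues j).card := by
  rw [rank, S.state_isHermitian.rank_eq_card_non_zero_eigs, Fintype.card_subtype]
  congr 1
  ext j
  simp only [Finset.mem_filter, Finset.mem_univ, true_and]
  exact ⟨fun h => lt_of_le_of_ne (S.eigenvalues_nonneg j) h.symm, fun h => h.ne'⟩

theorem sum_eigenvalues : ∑ j, S.state_isHermitian.eigenvalues j = 1 :=
  S.state_isDensity.sum_eigenvalues

theorem rank_pos : 0 < S.rank := by
  rw [rank_eq_card, Finset.card_pos]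
  by_contra h
  rw [Finset.not_nonempty_iff_eq_empty, Finset.filter_eq_empty_iff] at h
  have : ∑ j, S.state_isHermitian.eigenvalues j ≤ 0 :=
    Finset.sum_nonpos fun j _ => not_lt.1 (h (Finset.mem_univ j))
  rw [sum_eigenvalues] at this
  linarith

theorem rank_le : S.rank ≤ S.d := by
  rw [rank_eq_card]
  exact (Finset.card_le_univ _).trans (Fintype.card_fin _).le

/-- The eigenvalues sum to 1, and only r of them are nonzero, each at most κλ_j. -/
theorem inv_le_eigenvalue {κ : ℝ} (hκ : 0 < κ) (h : S.IsWellConditioned κ) {j : Fin S.d}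
    (hj : 0 < S.state_isHermitian.eigenvalues j) :
    1 / (S.rank * κ) ≤ S.state_isHermitian.eigenvalues j := by
  have hr : (0 : ℝ) < S.rank := by exact_mod_cast S.rank_pos
  rw [div_le_iff₀ (by positivity)]
  calc (1 : ℝ) = ∑ k, S.state_isHermitian.eigenvalues k := S.sum_eigenvalues.symm
    _ ≤ ∑ k, if 0 < S.state_isHermitian.eigenvalues k then
          κ * S.state_isHermitian.eigenvalues j else 0 := by
        refine Finset.sum_le_sum fun k _ => ?_
        split_ifs with hk
        · exact h k j hj
        · exact not_lt.1 hk
    _ = S.state_isHermitian.eigenvalues j * (S.rank * κ) := by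
        rw [← Finset.sum_filter, Finset.sum_const, ← rank_eq_card, nsmul_eq_mul]
        ring

/-- The 6 combines the 1/3 of the design bound with the factor 2 in `sldNormSq`; κr is the inverse
of the eigenvalue bound. -/
theorem cfim_sub_smul_qfim_posSemidef {κ : ℝ} (hκ : 0 < κ) (hwc : S.IsWellConditioned κ)
    {M : POVM S.d} (hM : M.IsThreeDesign) :
    (S.cfim M - (1 / (6 * κ * S.rank)) • S.qfim).PosSemidef := by
  have hr : (0 : ℝ) < S.rank := by exact_mod_cast S.rank_pos
  refine PosSemidef.of_dotProduct_mulVec_nonneg ?_ fun a => ?_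
  · refine (S.isHermitian_cfim M).sub ?_
    rw [Matrix.IsHermitian, Matrix.conjTranspose_smul, S.isHermitian_qfim.eq, star_trivial]
  · rw [star_trivial, Matrix.sub_mulVec, dotProduct_sub, Matrix.smul_mulVec, dotProduct_smul,
      dotProduct_qfim_mulVec, dotProduct_cfim_mulVec, smul_eq_mul]
    have h1 := hM.le_sum_sq_div S.state_isDensity (S.dirDeriv_isHermitian a)
      (S.trace_dirDeriv a) fun N hN h => S.re_trace_dirDeriv_mul_eq_zero a hN h
    rw [trace_mul_self_eq_sum S.state_isHermitian (S.dirDeriv_isHermitian a),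
      Complex.ofReal_re] at h1
    have h2 := sldNormSq_le S.state_isHermitian (c := 1 / (S.rank * κ)) (S.dirDeriv a)
      (by positivity) fun j k hjk => by
        have hj := S.eigenvalues_nonneg j
        have hk := S.eigenvalues_nonneg k
        rcases hj.lt_or_eq with h | h
        · linarith [S.inv_le_eigenvalue hκ hwc h]
        · rw [← h, zero_add] at hjk
          linarith [S.inv_le_eigenvalue hκ hwc hjk]
    refine sub_nonneg.2 (le_trans ?_ h1)
    refine (mul_le_mul_of_nonneg_left h2 (by positivity)).trans (le_of_eq ?_)
    field_simp
    ring

/-- Near-optimality of `3`-designs from an upper bound on the Fisher information of all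
measurements. -/
theorem nearOptimal_of_rank_mul_trace_le {κ : ℝ} (hκ : 0 < κ) (hwc : S.IsWellConditioned κ)
    (hid : S.IsIdentifiable) {M : POVM S.d} (hM : M.IsThreeDesign)
    (hup : ∀ N : POVM S.d, S.rank * (S.qfim⁻¹ * S.cfim N).trace ≤ S.m) :
    (S.cfim M).PosDef ∧
    S.weightedError M ≤ ENNReal.ofReal (6 * κ) * ⨅ N : POVM S.d, S.weightedError N ∧
    (S.cfim M - (1 / (6 * κ) * (Matrix.trace (S.qfim⁻¹ * S.cfim M) / (S.m : ℝ))) •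
      S.qfim).PosSemidef := by
  have hr : (0 : ℝ) < S.rank := by exact_mod_cast S.rank_pos
  have hJ := S.qfim_posDef hid
  have hsub := S.cfim_sub_smul_qfim_posSemidef hκ hwc hM
  have hγ : 0 < 1 / (6 * κ * S.rank) := by positivity
  have hpos : (S.cfim M).PosDef := by
    have := (hJ.smul hγ).add_posSemidef hsub
    rwa [add_sub_cancel] at this
  refine ⟨hpos, ?_, ?_⟩
  · have h1 : S.weightedError M ≤ ENNReal.ofReal (6 * κ * (S.rank * S.m)) := by
      rw [weightedError, if_pos hpos]
      apply ENNReal.ofReal_le_ofReal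
      refine (trace_mul_inv_le hpos hγ hsub).trans (le_of_eq ?_)
      field_simp
    have h2 : ENNReal.ofReal (S.rank * S.m) ≤ ⨅ N : POVM S.d, S.weightedError N := by
      refine le_iInf fun N => ?_
      rw [weightedError]
      split_ifs with hN
      · exact ENNReal.ofReal_le_ofReal (mul_le_trace_mul_inv hN hJ _ (hup N) hr.le)
      · exact le_top
    rw [ENNReal.ofReal_mul (by positivity)] at h1
    exact h1.trans (mul_le_mul_right h2 _)
  · have h1 : 1 / (6 * κ) * ((S.qfim⁻¹ * S.cfim M).trace / S.m) ≤ 1 / (6 * κ * S.rank) := by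
      have : (S.qfim⁻¹ * S.cfim M).trace / S.m ≤ 1 / S.rank := by
        -- This form of the lemma also covers m = 0, where the quotient is 0 by convention.
        apply div_le_of_le_mul₀ (by positivity) (by positivity)
        rw [div_mul_eq_mul_div, one_mul, le_div_iff₀ hr, mul_comm]
        exact hup M
      refine (mul_le_mul_of_nonneg_left this (by positivity)).trans (le_of_eq ?_)
      field_simp
    -- Shrinking the coefficient of J adds a nonnegative multiple of J.
    have h2 := hsub.add (hJ.posSemidef.smul (sub_nonneg.2 h1))
    convert h2 using 1
    rw [sub_smul]
    abel

theorem IsWellConditioned.mono {S : ParamState} {κ κ' : ℝ} (h : S.IsWellConditioned κ)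
    (hκ : κ ≤ κ') : S.IsWellConditioned κ' := fun k l hl =>
  (h k l hl).trans (mul_le_mul_of_nonneg_right hκ hl.le)

/-! ### Upper bounds for arbitrary measurements -/

theorem trace_inv_mul_cfim_le_of_block (hid : S.IsIdentifiable) (N : POVM S.d)
    {s : Fin S.d → Prop} [DecidablePred s]
    (hs : ∀ j, ¬ s j → S.state_isHermitian.eigenvalues j = 0)
    (h : ∀ i j k, ¬ (s j ∧ s k) → inEigenbasis S.state_isHermitian (S.pderiv i) j k = 0) :
    (S.qfim⁻¹ * S.cfim N).trace ≤ (Finset.univ.filter s).card - 1 := by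
  -- The subtracted 1 is the total probability, so the right side becomes the sum of `traceOn` minus
  -- p_x.
  rw [← sum_traceOn S.state_isHermitian, ← S.sum_prob N, ← Finset.sum_sub_distrib]
  refine S.trace_inv_mul_cfim_le (S.qfim_posDef hid) N (fun x => ?_) fun x a => ?_
  · rw [sub_nonneg]
    change (S.state * N.op x).trace.re ≤ _
    rw [trace_state_mul_re S.state_isHermitian, traceOn]
    refine Finset.sum_le_sum fun j _ => ?_
    split_ifs with hj
    · exact mul_le_of_le_one_left (Complex.le_def.1
        (inEigenbasis_posSemidef S.state_isHermitian (N.posSemidef x)).diag_nonneg).1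
        (S.state_isDensity.eigenvalues_le_one j)
    · rw [hs j hj, zero_mul]
  · exact sq_trace_le_of_block S.state_isHermitian (S.dirDeriv_vanishesOnKernel a)
      (S.trace_dirDeriv a) (N.posSemidef x) S.eigenvalues_nonneg S.sum_eigenvalues hs
      fun j k hjk => S.inEigenbasis_dirDeriv_eq_zero a fun i => h i j k hjk

theorem trace_inv_mul_cfim_le_of_offDiagonal (hid : S.IsIdentifiable) (N : POVM S.d)
    (h : ∀ i j k, 0 < S.state_isHermitian.eigenvalues j →
      0 < S.state_isHermitian.eigenvalues k →
      inEigenbasis S.state_isHermitian (S.pderiv i) j k = 0) :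
    (S.qfim⁻¹ * S.cfim N).trace ≤ S.d - S.rank := by
  have hcard : ((Finset.univ.filter fun j =>
      ¬ 0 < S.state_isHermitian.eigenvalues j).card : ℝ) = S.d - S.rank := by
    have := Finset.card_filter_add_card_filter_not (s := (Finset.univ : Finset (Fin S.d)))
      (fun j => 0 < S.state_isHermitian.eigenvalues j)
    rw [← rank_eq_card, Finset.card_univ, Fintype.card_fin] at this
    rw [eq_sub_iff_add_eq', ← Nat.cast_add, this]
  rw [← hcard, ← sum_traceOn S.state_isHermitian]
  refine S.trace_inv_mul_cfim_le (S.qfim_posDef hid) N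
    (fun x => traceOn_nonneg _ _ (N.posSemidef x)) fun x a => ?_
  exact sq_trace_le_of_offDiagonal S.state_isHermitian (S.dirDeriv_vanishesOnKernel a)
    (N.posSemidef x) S.eigenvalues_nonneg
    fun j k hj hk => S.inEigenbasis_dirDeriv_eq_zero a fun i => h i j k hj hk

theorem inEigenbasis_proj_mul_mul_proj (A : Matrix (Fin S.d) (Fin S.d) ℂ) (j k : Fin S.d) :
    inEigenbasis S.state_isHermitian (S.proj * A * S.proj) j k =
      (if 0 < S.state_isHermitian.eigenvalues j then 1 else 0) *
        inEigenbasis S.state_isHermitian A j k *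
      (if 0 < S.state_isHermitian.eigenvalues k then 1 else 0) := by
  rw [inEigenbasis_mul, inEigenbasis_mul, proj, inEigenbasis_supportProj, Matrix.mul_diagonal,
    Matrix.diagonal_mul]

end ParamState

/-- A criterion for weak near-optimality of `3`-designs for a family of well-conditioned
parameterized states. -/
theorem weaklyNearOptimal_of_rank_mul_trace_le {κ : ℝ} {F : (S : ParamState) → POVM S.d → Prop}
    (hF : ∀ S M, F S M → M.IsThreeDesign ∧ S.IsIdentifiable ∧ S.IsWellConditioned κ ∧
      ∀ N : POVM S.d, S.rank * (S.qfim⁻¹ * S.cfim N).trace ≤ S.m) : WeaklyNearOptimal F := by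
  -- An arbitrary real κ is enlarged so that the constants are positive.
  have hκ : 0 < max κ 1 := lt_max_of_lt_right one_pos
  refine ⟨6 * max κ 1, 1 / (6 * max κ 1), by positivity, by positivity, fun S M h => ?_⟩
  obtain ⟨hM, hid, hwc, hup⟩ := hF S M h
  exact S.nearOptimal_of_rank_mul_trace_le hκ (hwc.mono (le_max_left _ _)) hid hM hup

end QuantumMetrology

/-! ### The three families -/

theorem theorem4 (κ : ℝ) :
    -- (1) full-parameter rank-`r` states
    QuantumMetrology.WeaklyNearOptimal (fun S M =>
      M.IsThreeDesign ∧ S.IsIdentifiable ∧ S.IsWellConditioned κ ∧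
      (S.m : ℤ) = S.rank * (2 * S.d - S.rank) - 1) ∧
    -- (2) derivatives inside the support
    QuantumMetrology.WeaklyNearOptimal (fun S M =>
      M.IsThreeDesign ∧ S.IsIdentifiable ∧ S.IsWellConditioned κ ∧
      (∀ i, S.proj * S.pderiv i * S.proj = S.pderiv i) ∧
      (S.m : ℤ) = S.rank ^ 2 - 1) ∧
    -- (3) derivatives with vanishing block on the support
    QuantumMetrology.WeaklyNearOptimal (fun S M =>
      M.IsThreeDesign ∧ S.IsIdentifiable ∧ S.IsWellConditioned κ ∧
      (∀ i, S.proj * S.pderiv i * S.proj = 0) ∧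
      (S.m : ℤ) = 2 * S.rank * (S.d - S.rank)) := by
  refine ⟨?_, ?_, ?_⟩
  · refine QuantumMetrology.weaklyNearOptimal_of_rank_mul_trace_le (κ := κ)
      fun S M ⟨hM, hid, hwc, hm⟩ => ⟨hM, hid, hwc, fun N => ?_⟩
    -- The block is the whole space, which gives d - 1.
    have h := S.trace_inv_mul_cfim_le_of_block hid N (s := fun _ => True) (by simp) (by simp)
    rw [Finset.filter_true, Finset.card_univ, Fintype.card_fin] at h
    have hr : (1 : ℝ) ≤ S.rank := by exact_mod_cast S.rank_pos
    have hd : (S.rank : ℝ) ≤ S.d := by exact_mod_cast S.rank_le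
    have hm' : (S.m : ℝ) = S.rank * (2 * S.d - S.rank) - 1 := by exact_mod_cast hm
    rw [hm']
    -- The slack m - r(d-1) is r(d-r) + (r-1).
    nlinarith
  · refine QuantumMetrology.weaklyNearOptimal_of_rank_mul_trace_le (κ := κ)
      fun S M ⟨hM, hid, hwc, hP, hm⟩ => ⟨hM, hid, hwc, fun N => ?_⟩
    have h := S.trace_inv_mul_cfim_le_of_block hid N
      (s := fun j => 0 < S.state_isHermitian.eigenvalues j)
      (fun j hj => le_antisymm (not_lt.1 hj) (S.eigenvalues_nonneg j)) fun i j k hjk => by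
        rw [← hP i, S.inEigenbasis_proj_mul_mul_proj]
        by_cases hj : 0 < S.state_isHermitian.eigenvalues j
        · rw [if_neg fun hk => hjk ⟨hj, hk⟩, mul_zero]
        · rw [if_neg hj, zero_mul, zero_mul]
    rw [← S.rank_eq_card] at h
    have hr : (1 : ℝ) ≤ S.rank := by exact_mod_cast S.rank_pos
    have hm' : (S.m : ℝ) = S.rank ^ 2 - 1 := by exact_mod_cast hm
    rw [hm']
    -- The slack m - r(r-1) is r - 1.
    nlinarith
  · refine QuantumMetrology.weaklyNearOptimal_of_rank_mul_trace_le (κ := κ)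
      fun S M ⟨hM, hid, hwc, hP, hm⟩ => ⟨hM, hid, hwc, fun N => ?_⟩
    have h := S.trace_inv_mul_cfim_le_of_offDiagonal hid N fun i j k hj hk => by
      have h0 := S.inEigenbasis_proj_mul_mul_proj (S.pderiv i) j k
      rw [hP i, if_pos hj, if_pos hk, one_mul, mul_one] at h0
      rw [← h0]
      simp [QuantumMetrology.inEigenbasis]
    have hr : (1 : ℝ) ≤ S.rank := by exact_mod_cast S.rank_pos
    have hd : (S.rank : ℝ) ≤ S.d := by exact_mod_cast S.rank_le
    have hm' : (S.m : ℝ) = 2 * S.rank * (S.d - S.rank) := by exact_mod_cast hm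
    rw [hm']
    -- The slack m - r(d-r) is r(d-r).
    nlinarith
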